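/- **Setting.** Let $d\ge 1$, let $\mathrm{U}(d)$ be the group of $d\times d$ unitary matrices and $\|\cdot\|$ the operator norm. For $U,V\in \mathrm{U}(d)$ let $\mathrm{dist}(U,V)=\inf_\gamma\int_0^1\|\gamma'(t)\|\,dt$ over smooth paths $\gamma:[0,1]\to \mathrm{U}(d)$ from $U$ to $V$, and let $\mathrm{dist}(U,V\,\mathrm{U}(1))=\inf_{|\phi|=1}\mathrm{dist}(U,\phi V)$. For a skew-Hermitian $X$ with $\|X\|<\pi$ and $r>0$ put $(e^X)^r=e^{rX}$. For $U\in\mathrm{U}(d)$ known only up to a phase, $U^{1/p}$ means $(\phi U)^{1/p}$ for a phase $\phi$ such that $\phi U=e^X$ with $\|X\|<\pi$, and such that $\mathrm{dist}(\mathbb I,\phi U)<\frac1{3\pi}$ whenever $\mathrm{dist}(\mathbb I,U\,\mathrm U(1))<\frac1{3\pi}$ (any Borel rule that chooses $\phi$ is allowed). A *tomography algorithm* draws a random seed (of arbitrary distribution) and then, depending on it, runs an adaptive procedure on a qudit of dimension $d$ and a finite-dimensional ancilla, starting in the state $|0\rangle$: it applies an oracle $Z\in\mathrm{U}(d)$ to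 the qudit (a query), or performs a quantum instrument with finitely many outcomes, each step depending on the outcomes so far, and finally it outputs a unitary $\boldsymbol U\in\mathrm{U}(d)$. It uses $Q$ queries if it never makes more than $Q$ queries, for any seed and any outcomes. **Bootstrap algorithm.** Let $\mathcal A$ be a tomography algorithm, $\varepsilon_0\le\frac1{600}$, $\varepsilon,\eta\in(0,1)$, $c>0$. Put $T=\lceil\log_2(1/\varepsilon)\rceil$ and $V_0=\mathbb I$. For $j=0,\dots,T$ let $p_j=2^j$, $\eta_j=\eta\, 8^{\,j-T-1}$, $N_j=\lceil c\log(1/\eta_j)\rceil$; run $\mathcal A$ independently $N_j$ times with the oracle $(ZV_j^\dagger)^{p_j}$ (each of whose applications costs $p_j$ queries to $Z$); let $U_j$ be the first of the $N_j$ outputs $W$ that are *central*, i.e. such that at least $0.505N_j$ of the outputs $W'$ satisfy $\mathrm{dist}(W,W'\,\mathrm{U}(1))\le 2\varepsilon_0$ (and $U_j=\mathbb I$ if there is none); and put $V_{j+1}=U_j^{1/p_j}V_j$. Output $\boldsymbol U=V_{T+1}$. **Theorem.** There are universal constants $c,C>0$ with the following property. Let $d\ge1$, $\varepsilon_0\le\frac{1}{600}$,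 and let $\mathcal A$ be a tomography algorithm which, for every oracle $Z\in\mathrm{U}(d)$, outputs $\boldsymbol U$ with $\mathrm{dist}(Z,\boldsymbol U\,\mathrm{U}(1))\le\varepsilon_0$ with probability $>0.51$. Then for all $\varepsilon,\eta\in(0,1)$ and every oracle $Z\in\mathrm{U}(d)$ the output $\boldsymbol U$ of the bootstrap algorithm satisfies (a) $\mathrm{dist}(Z,\boldsymbol U\,\mathrm{U}(1))\le\varepsilon$ with probability $\ge 1-\eta$; (b) $\mathbb E[\mathrm{dist}(Z,\boldsymbol U\,\mathrm{U}(1))^2]\le(1+32\eta)\varepsilon^2$. If moreover $\mathcal A$ uses $Q$ queries, then the bootstrap algorithm uses at most $C\,\frac{Q}{\varepsilon}\max\{1,\log\frac1\eta\}$ queries to $Z$. -/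

import Mathlib

open MeasureTheory
open scoped Matrix Kronecker Matrix.Norms.L2Operator ContDiff

noncomputable section

namespace Tomography

/-! ### The unitary group and its intrinsic metrics

Matrices carry the operator norm (largest singular value), through the scope
`Matrix.Norms.L2Operator`. -/

/-- The group of `d × d` unitary matrices. -/
abbrev UU (d : ℕ) : Type := Matrix.unitaryGroup (Fin d) ℂ

instance (d : ℕ) : MeasurableSpace (UU d) := borel _

instance (d : ℕ) : BorelSpace (UU d) := ⟨rfl⟩

/-- `γ` restricts to a smooth path `[0,1] → U(d)` from `U` to `V`. -/
structure IsSmoothPath {d : ℕ} (U V : Matrix (Fin d) (Fin d) ℂ)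
    (γ : ℝ → Matrix (Fin d) (Fin d) ℂ) : Prop where
  smooth : ContDiffOn ℝ ∞ γ (Set.Icc 0 1)
  unitary : ∀ t ∈ Set.Icc (0 : ℝ) 1, γ t ∈ Matrix.unitaryGroup (Fin d) ℂ
  source : γ 0 = U
  target : γ 1 = V

/-- The length of a path on `[0,1]`, measured in operator norm. -/
def pathLength {d : ℕ} (γ : ℝ → Matrix (Fin d) (Fin d) ℂ) : ℝ :=
  ∫ t in (0 : ℝ)..1, ‖derivWithin γ (Set.Icc 0 1) t‖

/-- The intrinsic distance `dist(U, V)` of unitary matrices. -/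
def idist {d : ℕ} (U V : Matrix (Fin d) (Fin d) ℂ) : ℝ :=
  sInf {l : ℝ | ∃ γ, IsSmoothPath U V γ ∧ l = pathLength γ}

/-- The projective intrinsic distance `dist(U, V U(1)) = inf_φ dist(U, φ V)`. -/
def pdist {d : ℕ} (U V : Matrix (Fin d) (Fin d) ℂ) : ℝ :=
  ⨅ φ : Circle, idist U ((φ : ℂ) • V)

/-! ### Roots -/

/-- `W = U ^ r`, the fractional power: `(e ^ X) ^ r = e ^ (r X)` for skew-Hermitian `X` with
`‖X‖ < π`. -/
def IsFracPow {d : ℕ} (r : ℝ) (U W : Matrix (Fin d) (Fin d) ℂ) : Prop :=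
  ∃ X : Matrix (Fin d) (Fin d) ℂ, Xᴴ = -X ∧ ‖X‖ < Real.pi ∧
    NormedSpace.exp X = U ∧ W = NormedSpace.exp (r • X)

/-- `W` is the `p`-th root of a representative `φ U` of the class `U(1) U`. The representative
lies in the ball of radius `1 / (3 π)` around the identity whenever the class meets this ball;
otherwise it is any representative for which the root is defined. -/
def IsProjRoot {d : ℕ} (p : ℕ) (U W : Matrix (Fin d) (Fin d) ℂ) : Prop :=
  ∃ φ : Circle,
    (pdist 1 U < 1 / (3 * Real.pi) → idist 1 ((φ : ℂ) • U) < 1 / (3 * Real.pi)) ∧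
    IsFracPow (1 / (p : ℝ)) ((φ : ℂ) • U) W

/-- A (Borel) rule for taking roots of unitaries that are known up to a phase. -/
structure IsRootRule {d : ℕ} (root : ℕ → UU d → UU d) : Prop where
  isProjRoot : ∀ p : ℕ, 1 ≤ p → ∀ U : UU d, IsProjRoot p (U : Matrix (Fin d) (Fin d) ℂ) (root p U)
  measurable : ∀ p : ℕ, Measurable (root p)

/-! ### Quantum query algorithms -/

/-- Index set of the computational basis of the register: the qudit on which the oracle acts,
and an ancilla of dimension `k + 1`. -/
abbrev Reg (d k : ℕ) : Type := Fin d × Fin (k + 1)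

/-- Operators on the register. -/
abbrev Op (d k : ℕ) : Type := Matrix (Reg d k) (Reg d k) ℂ

/-- An adaptive quantum query algorithm: it halts with a classical description of a unitary,
or it applies the oracle to the qudit, or it performs a quantum instrument, given by its Kraus
operators, and continues depending on the observed outcome. Known unitaries, preparations,
measurements and classical coins are all instruments. -/
inductive Prog (d k : ℕ) : Type
  | output (U : UU d) : Prog d k
  | query (next : Prog d k) : Prog d k
  | instrument {m : ℕ} (K : Fin m → Op d k) (hK : ∑ i, (K i)ᴴ * K i = 1)
      (next : Fin m → Prog d k) : Prog d k

/-- The operator `U ⊗ 1` on the register. -/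
def onQudit {d : ℕ} (k : ℕ) (U : UU d) : Op d k :=
  (U : Matrix (Fin d) (Fin d) ℂ) ⊗ₖ (1 : Matrix (Fin (k + 1)) (Fin (k + 1)) ℂ)

theorem onQudit_isometry {d : ℕ} (k : ℕ) (U : UU d) :
    (onQudit k U)ᴴ * onQudit k U = 1 := by
  have h : (U : Matrix (Fin d) (Fin d) ℂ)ᴴ * (U : Matrix (Fin d) (Fin d) ℂ) = 1 :=
    Matrix.UnitaryGroup.star_mul_self U
  rw [onQudit, Matrix.conjTranspose_kronecker, ← Matrix.mul_kronecker_mul, h,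
    Matrix.conjTranspose_one, Matrix.one_mul, Matrix.one_kronecker_one]

namespace Prog

variable {d k : ℕ}

/-- The largest number of oracle queries along a branch. -/
def queries : Prog d k → ℕ
  | output _ => 0
  | query next => next.queries + 1
  | instrument _ _ next => Finset.univ.sup fun i => (next i).queries

/-- The distribution of the output if the oracle is `Z` and the register is in the
(subnormalized) state `ρ`. -/
def run (Z : UU d) : Prog d k → Op d k → Measure (UU d)
  | output U, ρ => ENNReal.ofReal ρ.trace.re • Measure.dirac U
  | query next, ρ => next.run Z (onQudit k Z * ρ * (onQudit k Z)ᴴ)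
  | instrument K _ next, ρ => ∑ i, (next i).run Z (K i * ρ * (K i)ᴴ)

/-- The initial state `|0⟩⟨0|` of the register. -/
def initial (d k : ℕ) [NeZero d] : Op d k := Matrix.single (0, 0) (0, 0) 1

/-- The output distribution with oracle `Z`, started in the initial state. -/
def out [NeZero d] (P : Prog d k) (Z : UU d) : Measure (UU d) := P.run Z (initial d k)

/-- Apply the known unitary `U` to the qudit. -/
def gate (U : UU d) (next : Prog d k) : Prog d k :=
  instrument (m := 1) (fun _ => onQudit k U) (by simpa using onQudit_isometry k U) fun _ => next

/-- Kraus operators `|0⟩⟨i|` of the reset of the register. -/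
def resetKraus (d k : ℕ) [NeZero d] (i : Fin (d * (k + 1))) : Op d k :=
  Matrix.single (0, 0) (finProdFinEquiv.symm i) 1

theorem resetKraus_sum (d k : ℕ) [NeZero d] :
    ∑ i, (resetKraus d k i)ᴴ * resetKraus d k i = 1 := by
  have h : ∀ i, (resetKraus d k i)ᴴ * resetKraus d k i =
      (fun x : Reg d k => Matrix.single x x (1 : ℂ)) (finProdFinEquiv.symm i) := by
    intro i
    simp [resetKraus, Matrix.conjTranspose_single]
  rw [Finset.sum_congr rfl fun i _ => h i,
    Equiv.sum_comp finProdFinEquiv.symm fun x : Reg d k => Matrix.single x x (1 : ℂ)]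
  ext a b
  simp [Matrix.sum_apply, Matrix.single_apply, Matrix.one_apply, Finset.filter_and,
    Finset.filter_eq']
  by_cases hab : a = b <;> simp [hab]

/-- Put the register back into its initial state. -/
def reset [NeZero d] (next : Prog d k) : Prog d k :=
  instrument (resetKraus d k) (resetKraus_sum d k) fun _ => next

/-- Run a program, reset the register and go on with a program that depends on the output. -/
def bind [NeZero d] (g : UU d → Prog d k) : Prog d k → Prog d k
  | output U => reset (g U)
  | query next => query (next.bind g)
  | instrument K hK next => instrument K hK fun i => (next i).bind g

/-- Apply `(Z V†) ^ p` to the qudit, by `p` queries to `Z`. -/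
def queryPow (V : UU d) : ℕ → Prog d k → Prog d k
  | 0, next => next
  | p + 1, next => gate V⁻¹ (query (queryPow V p next))

/-- Replace the oracle `Z` of a program by `(Z V†) ^ p`. -/
def withOracle (V : UU d) (p : ℕ) : Prog d k → Prog d k
  | output U => output U
  | query next => queryPow V p (next.withOracle V p)
  | instrument K hK next => instrument K hK fun i => (next i).withOracle V p

/-- Run `n` programs one after the other and go on depending on all the outputs. -/
def runAll [NeZero d] : {n : ℕ} → (Fin n → Prog d k) → ((Fin n → UU d) → Prog d k) → Prog d k
  | 0, _, g => g Fin.elim0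
  | _ + 1, P, g => (P 0).bind fun U => runAll (Fin.tail P) fun u => g (Fin.cons U u)

end Prog

/-- A tomography algorithm: a random seed of arbitrary distribution is drawn, and then a
query algorithm that depends on the seed is executed. -/
structure Estimator (d : ℕ) where
  Seed : Type
  [measSeed : MeasurableSpace Seed]
  μ : Measure Seed
  [prob : IsProbabilityMeasure μ]
  ancilla : ℕ
  prog : Seed → Prog d ancilla

attribute [instance] Estimator.measSeed Estimator.prob

namespace Estimator

variable {d : ℕ}

/-- The output distribution depends measurably on the seed, so that the output is a random
variable. -/
def IsMeasurable [NeZero d] (A : Estimator d) : Prop :=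
  ∀ Z : UU d, Measurable fun s => (A.prog s).out Z

/-- The law of the output when the oracle is `Z`. -/
def law [NeZero d] (A : Estimator d) (Z : UU d) : Measure (UU d) :=
  A.μ.bind fun s => (A.prog s).out Z

/-- `A` never uses more than `q` queries. -/
def UsesAtMost (A : Estimator d) (q : ℝ) : Prop :=
  ∀ s, ((A.prog s).queries : ℝ) ≤ q

end Estimator

/-! ### The bootstrap algorithm -/

/-- The estimate `u i` is central: at least `0.505 n` of the `n` estimates are within `r`. -/
def IsCentral {d n : ℕ} (r : ℝ) (u : Fin n → UU d) (i : Fin n) : Prop :=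
  0.505 * (n : ℝ) ≤ ({j : Fin n | pdist (u i : Matrix (Fin d) (Fin d) ℂ) (u j) ≤ r}.ncard : ℝ)

open Classical in
/-- The first central estimate (the identity if there is none). -/
def central {d n : ℕ} (r : ℝ) (u : Fin n → UU d) : UU d :=
  if h : (Finset.univ.filter (IsCentral r u)).Nonempty then
    u ((Finset.univ.filter (IsCentral r u)).min' h)
  else 1

/-- The main loop with the current estimate `V`. A round with exponent `p 0` and `N 0`
repetitions estimates `(Z V†) ^ (p 0)` by the central one, `U`, among `N 0` independent runs of
the base algorithm, and replaces `V` by `U ^ (1 / p 0) V`. -/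
def bootLoop {d : ℕ} [NeZero d] (A : Estimator d) (root : ℕ → UU d → UU d) (r : ℝ) :
    {n : ℕ} → (p N : Fin n → ℕ) → ((j : Fin n) → Fin (N j) → A.Seed) → UU d → Prog d A.ancilla
  | 0, _, _, _, V => Prog.output V
  | _ + 1, p, N, s, V =>
      Prog.runAll (fun i => (A.prog (s 0 i)).withOracle V (p 0)) fun u =>
        bootLoop A root r (fun j => p j.succ) (fun j => N j.succ) (fun j => s j.succ)
          (root (p 0) (central r u) * V)

/-- `T = ⌈log₂ (1 / ε)⌉`. -/
def rounds (ε : ℝ) : ℕ := ⌈Real.logb 2 (1 / ε)⌉₊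

/-- `η_j = η 8 ^ (j - T - 1)`. -/
def failure (ε η : ℝ) (j : ℕ) : ℝ := η * (8 : ℝ) ^ ((j : ℤ) - rounds ε - 1)

/-- The number `⌈c log (1 / η_j)⌉` of runs of the base algorithm in round `j`. -/
def repetitions (c ε η : ℝ) (j : ℕ) : ℕ := ⌈c * Real.log (1 / failure ε η j)⌉₊

/-- The bootstrap algorithm built on the base algorithm `A` of accuracy `ε₀`: rounds
`j = 0, …, T` with exponents `2 ^ j`, starting from the estimate `1`. All runs of `A` use
independent seeds. -/
def bootstrap {d : ℕ} [NeZero d] (c : ℝ) (A : Estimator d) (root : ℕ → UU d → UU d)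
    (ε₀ ε η : ℝ) : Estimator d where
  Seed := (j : Fin (rounds ε + 1)) → Fin (repetitions c ε η j) → A.Seed
  μ := Measure.pi fun _ => Measure.pi fun _ => A.μ
  ancilla := A.ancilla
  prog s := bootLoop A root (2 * ε₀) (fun j => 2 ^ (j : ℕ)) (fun j => repetitions c ε η j) s 1

end Tomography

end

/-! ### Exponentials of skew-adjoint elements of a C⋆-algebra -/

section SkewExp

open NormedSpace

variable {A : Type*} [CStarAlgebra A]

/-! The invariant is `pdist Z V_j < 0.04 / 2^j`. If it holds, then up to a phase `Z V_j†` is `exp X`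
with `X` of norm at most about `0.063 / p`, where `p = 2^j`. Its `p`-th power therefore still has a
small logarithm `p X`. Near the identity the logarithm is Lipschitz
(`norm_sub_le_of_norm_add_norm_le`), so an estimate of the power with constant error determines `p
X` with constant error, up to a scalar. Taking the root divides this error by `p`, and the constants
are such that the error of the new estimate is below `0.02 / p` (`pdist_projRoot_mul_lt`). After
rounds `0, …, T` the error is below `0.04 / 2^(T+1) ≤ ε`.

A round is good if at least a fraction 0.505 of the runs are accurate. Two such majorities
intersect, so the chosen output has error at most `3 ε₀ ≤ 1/200` (`pdist_central_le`). As a single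
run succeeds with probability above 0.51, a Chernoff bound makes round `j` bad with probability at
most `η_j` (`lintegral_chernoffWeight_le`, `exp_pow_repetitions_le`).

A bad round does limited damage: a `p`-th root moves the estimate by at most `π / p`, and the
exponents double. If `j` is the first bad round, the final error is at most `3π / 2^j`, whatever
happens later. Hence the expectation of a loss is at most its bound on accurate outputs plus the sum
over `j` of `η_j` times its bound at error `3π / 2^j` (`expectedLoss_le`). The indicator of failure
yields (a) and the squared distance yields (b); the factor `8^j` in `η_j` outweighs the `4^j` gained
in accuracy, so late rounds dominate the sum and it is of order `η ε²`.

The query cost is the sum of `2^j N_j Q`. Here `N_j` grows only linearly in `T + 1 - j`, so the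
geometric factor absorbs it and no logarithm of `1/ε` is lost. -/

theorem norm_mul_of_mem_unitary {U : A} (hU : U ∈ unitary A) (X : A) : ‖U * X‖ = ‖X‖ :=
  CStarRing.norm_mem_unitary_mul X hU

theorem norm_mul_of_mem_unitary_right {U : A} (hU : U ∈ unitary A) (X : A) : ‖X * U‖ = ‖X‖ :=
  CStarRing.norm_mul_mem_unitary X hU

theorem exp_mem_unitary_of_star_eq_neg {X : A} (hX : star X = -X) : exp X ∈ unitary A := by
  let +nondep : NormedAlgebra ℚ A := .restrictScalars ℚ ℂ A
  exact exp_mem_unitary_of_mem_skewAdjoint (skewAdjoint.mem_iff.2 hX)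

/-- The spectral theorem gives `‖exp X - 1‖ = 2 sin (‖X‖ / 2)` in this range, and Jordan's
inequality bounds the sine from below. -/
theorem norm_le_half_pi_mul_norm_exp_sub_one {X : A} (hX : star X = -X)
    (hle : ‖X‖ ≤ Real.pi) : ‖X‖ ≤ Real.pi / 2 * ‖exp X - 1‖ := by
  have hsa : IsSelfAdjoint ((-Complex.I) • X) := by
    rw [isSelfAdjoint_iff, star_smul, hX]; simp
  let x : selfAdjoint A := ⟨(-Complex.I) • X, hsa⟩
  have hxn : ‖x‖ = ‖X‖ := by
    change ‖(-Complex.I) • X‖ = _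
    rw [norm_smul]; simp
  have h1 := selfAdjoint.norm_sq_expUnitary_sub_one (x := x) (by rw [hxn]; exact hle)
  have h2 : ((selfAdjoint.expUnitary x : unitary A) : A) = exp X := by
    rw [selfAdjoint.expUnitary_coe]
    congr 1
    change Complex.I • ((-Complex.I) • X) = X
    rw [smul_smul]; simp
  rw [h2, hxn] at h1
  have h3 : ‖exp X - 1‖ ^ 2 = (2 * Real.sin (‖X‖ / 2)) ^ 2 := by
    rw [h1, mul_pow, Real.sin_sq_eq_half_sub]
    ring_nf
  have hs : 2 / Real.pi * (‖X‖ / 2) ≤ Real.sin (‖X‖ / 2) :=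
    Real.mul_le_sin (by positivity) (by linarith)
  have hpi := Real.pi_pos
  have hs0 : 0 ≤ Real.sin (‖X‖ / 2) := le_trans (by positivity) hs
  have h4 : ‖exp X - 1‖ = 2 * Real.sin (‖X‖ / 2) :=
    (pow_left_inj₀ (norm_nonneg _) (by positivity) two_ne_zero).1 h3
  rw [h4]
  calc ‖X‖ = Real.pi * (2 / Real.pi * (‖X‖ / 2)) := by field_simp
    _ ≤ Real.pi * Real.sin (‖X‖ / 2) := by gcongr
    _ = _ := by ring

theorem exists_exp_eq_of_norm_sub_one_lt {U : A} (hU : U ∈ unitary A) (h : ‖U - 1‖ < 2) :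
    ∃ X : A, star X = -X ∧ ‖X‖ ≤ Real.pi / 2 * ‖U - 1‖ ∧ exp X = U := by
  let u : unitary A := ⟨U, hU⟩
  have h1 := expUnitary_argSelfAdjoint (u := u) h
  let x := Unitary.argSelfAdjoint u
  have hst : star (Complex.I • (x : A)) = -(Complex.I • (x : A)) := by
    rw [star_smul, selfAdjoint.mem_iff.1 x.2]; simp
  have hex : exp (Complex.I • (x : A)) = U := by
    rw [← selfAdjoint.expUnitary_coe]; exact congrArg Subtype.val h1
  have hn : ‖Complex.I • (x : A)‖ ≤ Real.pi := by
    rw [norm_smul, Complex.norm_I, one_mul]; exact Unitary.norm_argSelfAdjoint_le_pi u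
  refine ⟨_, hst, ?_, hex⟩
  rw [← hex]
  exact norm_le_half_pi_mul_norm_exp_sub_one hst hn

theorem star_real_smul_eq_neg {X : A} (hX : star X = -X) (t : ℝ) : star (t • X) = -(t • X) := by
  rw [star_smul, hX]; simp

theorem hasDerivAt_exp_smul_mul_exp_smul_neg (X Y : A) (t : ℝ) :
    HasDerivAt (fun s : ℝ => exp (s • X) * exp (s • -Y))
      (exp (t • X) * (X - Y) * exp (t • -Y)) t := by
  have h1 : HasDerivAt (fun s : ℝ => exp (s • X)) (exp (t • X) * X) t :=
    hasDerivAt_exp_smul_const X t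
  have h2 : HasDerivAt (fun s : ℝ => exp (s • -Y)) (-Y * exp (t • -Y)) t :=
    hasDerivAt_exp_smul_const' (-Y) t
  refine (h1.mul h2).congr_deriv ?_
  noncomm_ring

theorem norm_exp_mul_exp_neg_sub_one_le {X Y : A} (hX : star X = -X) (hY : star Y = -Y) :
    ‖exp X * exp (-Y) - 1‖ ≤ ‖X - Y‖ := by
  have hY' : star (-Y) = - -Y := by rw [star_neg, hY]
  have := norm_image_sub_le_of_norm_deriv_le_segment_01' (C := ‖X - Y‖)
    (f := fun s : ℝ => exp (s • X) * exp (s • -Y))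
    (fun t _ => (hasDerivAt_exp_smul_mul_exp_smul_neg X Y t).hasDerivWithinAt)
    (fun t _ => by
      rw [norm_mul_of_mem_unitary_right
        (exp_mem_unitary_of_star_eq_neg (star_real_smul_eq_neg hY' t)),
        norm_mul_of_mem_unitary (exp_mem_unitary_of_star_eq_neg (star_real_smul_eq_neg hX t))])
  simpa using this

theorem norm_exp_sub_one_le {X : A} (hX : star X = -X) : ‖exp X - 1‖ ≤ ‖X‖ := by
  simpa using norm_exp_mul_exp_neg_sub_one_le hX (Y := 0) (by simp)

/-- The derivative `exp (tX) (X - Y) exp (-tY)` stays close to `X - Y`, since each unitary factor is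
within `‖X‖` or `‖Y‖` of 1. This replaces the Baker–Campbell–Hausdorff expansion. -/
theorem norm_exp_mul_exp_neg_sub_one_sub_le {X Y : A} (hX : star X = -X) (hY : star Y = -Y) :
    ‖exp X * exp (-Y) - 1 - (X - Y)‖ ≤ ‖X - Y‖ * (‖X‖ + ‖Y‖) := by
  have hY' : star (-Y) = - -Y := by rw [star_neg, hY]
  have := norm_image_sub_le_of_norm_deriv_le_segment_01' (C := ‖X - Y‖ * (‖X‖ + ‖Y‖))
    (f := fun s : ℝ => exp (s • X) * exp (s • -Y) - s • (X - Y))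
    (f' := fun t => exp (t • X) * (X - Y) * exp (t • -Y) - (1 : ℝ) • (X - Y))
    (fun t _ => ((hasDerivAt_exp_smul_mul_exp_smul_neg X Y t).sub
      ((hasDerivAt_id t).smul_const (X - Y))).hasDerivWithinAt)
    (fun t ht => by
      have hXt := star_real_smul_eq_neg hX t
      have hYt := star_real_smul_eq_neg hY' t
      have e : exp (t • X) * (X - Y) * exp (t • -Y) - (1 : ℝ) • (X - Y) =
          (exp (t • X) - 1) * (X - Y) * exp (t • -Y) + (X - Y) * (exp (t • -Y) - 1) := by
        rw [one_smul]; noncomm_ring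
      have ht' : |t| ≤ 1 := abs_le.2 ⟨by linarith [ht.1], ht.2.le⟩
      have hb : ∀ W : A, star W = -W → ‖exp (t • W) - 1‖ ≤ ‖W‖ := fun W hW => by
        refine (norm_exp_sub_one_le (star_real_smul_eq_neg hW t)).trans ?_
        rw [norm_smul]
        exact mul_le_of_le_one_left (norm_nonneg _) ht'
      rw [e]
      refine (norm_add_le _ _).trans ?_
      rw [norm_mul_of_mem_unitary_right (exp_mem_unitary_of_star_eq_neg hYt)]
      have h1 := (norm_mul_le (exp (t • X) - 1) (X - Y)).trans
        (mul_le_mul_of_nonneg_right (hb X hX) (norm_nonneg _))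
      have h2 := (norm_mul_le (X - Y) (exp (t • -Y) - 1)).trans
        (mul_le_mul_of_nonneg_left (hb (-Y) hY') (norm_nonneg _))
      rw [norm_neg] at h2
      linarith)
  simpa [sub_right_comm] using this

theorem norm_exp_mul_exp_neg_sub_one {X Y : A} (hY : star Y = -Y) :
    ‖exp X * exp (-Y) - 1‖ = ‖exp X - exp Y‖ := by
  let +nondep : NormedAlgebra ℚ A := .restrictScalars ℚ ℂ A
  have h : exp (-Y) * exp Y = 1 := by
    rw [← exp_add_of_commute (Commute.refl Y).neg_left]; simp
  rw [← norm_mul_of_mem_unitary_right (exp_mem_unitary_of_star_eq_neg hY), sub_mul, mul_assoc, h,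
    mul_one, one_mul]

/-- The logarithm of unitaries is Lipschitz near the identity. -/
theorem norm_sub_le_of_norm_add_norm_le {X Y : A} (hX : star X = -X) (hY : star Y = -Y)
    (h : ‖X‖ + ‖Y‖ ≤ 11 / 20) : ‖X - Y‖ ≤ 20 / 9 * ‖exp X - exp Y‖ := by
  have h1 := norm_exp_mul_exp_neg_sub_one_sub_le hX hY
  -- The second-order error consumes 11/20 of `‖X - Y‖`; the remaining 9/20 gives the constant 20/9.
  have h2 : ‖X - Y‖ * (‖X‖ + ‖Y‖) ≤ ‖X - Y‖ * (11 / 20) := by gcongr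
  have h3 : ‖X - Y‖ ≤ ‖exp X * exp (-Y) - 1‖ + ‖exp X * exp (-Y) - 1 - (X - Y)‖ := by
    have := norm_sub_le (exp X * exp (-Y) - 1) (exp X * exp (-Y) - 1 - (X - Y))
    rwa [sub_sub_cancel] at this
  rw [← norm_exp_mul_exp_neg_sub_one hY]
  linarith

theorem norm_exp_sub_exp_le {X Y : A} (hX : star X = -X) (hY : star Y = -Y) :
    ‖exp X - exp Y‖ ≤ ‖X - Y‖ := by
  rw [← norm_exp_mul_exp_neg_sub_one hY]
  exact norm_exp_mul_exp_neg_sub_one_le hX hY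

end SkewExp

namespace Tomography

/-! ### The intrinsic metric -/

section Metric

variable {d : ℕ}

local notation "𝐌" => Matrix (Fin d) (Fin d) ℂ

theorem coe_mem_unitary (U : UU d) : (U : 𝐌) ∈ unitary 𝐌 := U.2

theorem circle_smul_mem_unitary (φ : Circle) {U : 𝐌} (hU : U ∈ unitary 𝐌) :
    (φ : ℂ) • U ∈ unitary 𝐌 := by
  rw [Unitary.mem_iff] at hU ⊢
  have h1 : star (φ : ℂ) * (φ : ℂ) = 1 := by
    rw [Complex.star_def, ← Circle.coe_inv_eq_conj, ← Circle.coe_mul]; simp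
  have h2 : (φ : ℂ) * star (φ : ℂ) = 1 := by rw [mul_comm, h1]
  rw [star_smul, smul_mul_smul_comm, smul_mul_smul_comm, hU.1, hU.2, h1, h2]
  simp

theorem circle_inv_smul_smul (φ : Circle) (U : 𝐌) : ((φ⁻¹ : Circle) : ℂ) • (φ : ℂ) • U = U := by
  rw [smul_smul, ← Circle.coe_mul]; simp

theorem IsSmoothPath.hasDerivWithinAt {U V : 𝐌} {γ : ℝ → 𝐌} (h : IsSmoothPath U V γ) {t : ℝ}
    (ht : t ∈ Set.Icc (0 : ℝ) 1) :
    HasDerivWithinAt γ (derivWithin γ (Set.Icc 0 1) t) (Set.Icc 0 1) t :=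
  ((h.smooth.differentiableOn (by simp)) t ht).hasDerivWithinAt

theorem IsSmoothPath.continuousOn_derivWithin {U V : 𝐌} {γ : ℝ → 𝐌} (h : IsSmoothPath U V γ) :
    ContinuousOn (derivWithin γ (Set.Icc 0 1)) (Set.Icc 0 1) :=
  h.smooth.continuousOn_derivWithin (uniqueDiffOn_Icc zero_lt_one) (by simp)

theorem IsSmoothPath.intervalIntegrable {U V : 𝐌} {γ : ℝ → 𝐌} (h : IsSmoothPath U V γ) :
    IntervalIntegrable (fun t => ‖derivWithin γ (Set.Icc 0 1) t‖) volume 0 1 := by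
  apply ContinuousOn.intervalIntegrable
  rw [Set.uIcc_of_le zero_le_one]
  exact h.continuousOn_derivWithin.norm

theorem pathLength_nonneg (γ : ℝ → 𝐌) : 0 ≤ pathLength γ :=
  intervalIntegral.integral_nonneg zero_le_one fun _ _ => norm_nonneg _

theorem bddBelow_pathLengths (U V : 𝐌) :
    BddBelow {l : ℝ | ∃ γ, IsSmoothPath U V γ ∧ l = pathLength γ} :=
  ⟨0, by rintro _ ⟨γ, -, rfl⟩; exact pathLength_nonneg γ⟩

theorem idist_nonneg (U V : 𝐌) : 0 ≤ idist U V :=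
  Real.sInf_nonneg (by rintro _ ⟨γ, -, rfl⟩; exact pathLength_nonneg γ)

theorem idist_le_pathLength {U V : 𝐌} {γ : ℝ → 𝐌} (h : IsSmoothPath U V γ) :
    idist U V ≤ pathLength γ :=
  csInf_le (bddBelow_pathLengths U V) ⟨γ, h, rfl⟩

theorem pathLength_le_of_norm_le {U V : 𝐌} {γ : ℝ → 𝐌} (h : IsSmoothPath U V γ) {f : ℝ → ℝ}
    (hf : IntervalIntegrable f volume 0 1)
    (hle : ∀ t ∈ Set.Icc (0 : ℝ) 1, ‖derivWithin γ (Set.Icc 0 1) t‖ ≤ f t) :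
    pathLength γ ≤ ∫ t in (0 : ℝ)..1, f t :=
  intervalIntegral.integral_mono_on zero_le_one h.intervalIntegrable hf hle

theorem norm_sub_le_pathLength {U V : 𝐌} {γ : ℝ → 𝐌} (h : IsSmoothPath U V γ) :
    ‖U - V‖ ≤ pathLength γ := by
  have hd : ∫ t in (0 : ℝ)..1, derivWithin γ (Set.Icc 0 1) t = γ 1 - γ 0 := by
    refine intervalIntegral.integral_eq_sub_of_hasDerivAt_of_le zero_le_one
      h.smooth.continuousOn (fun t ht => ?_) ?_
    · exact (h.hasDerivWithinAt (Set.Ioo_subset_Icc_self ht)).hasDerivAt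
        (Icc_mem_nhds ht.1 ht.2)
    · apply ContinuousOn.intervalIntegrable
      rw [Set.uIcc_of_le zero_le_one]
      exact h.continuousOn_derivWithin
  rw [norm_sub_rev, ← h.source, ← h.target, ← hd]
  exact intervalIntegral.norm_integral_le_integral_norm zero_le_one

/-- The path `t ↦ U exp (t X)`. -/
theorem isSmoothPath_mul_exp {U X : 𝐌} (hU : U ∈ unitary 𝐌) (hX : star X = -X) :
    IsSmoothPath U (U * NormedSpace.exp X) (fun t => U * NormedSpace.exp (t • X)) where
  smooth := by
    have h : ContDiff ℝ ∞ (NormedSpace.exp : 𝐌 → 𝐌) :=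
      AnalyticOnNhd.contDiff fun x _ => NormedSpace.exp_analytic (𝕂 := ℝ) x
    exact (contDiff_const.mul (h.comp (contDiff_id.smul contDiff_const))).contDiffOn
  unitary t _ := mul_mem hU (exp_mem_unitary_of_star_eq_neg (star_real_smul_eq_neg hX t))
  source := by simp
  target := by simp

theorem idist_mul_exp_le {U X : 𝐌} (hU : U ∈ unitary 𝐌) (hX : star X = -X) :
    idist U (U * NormedSpace.exp X) ≤ ‖X‖ := by
  have h := isSmoothPath_mul_exp hU hX
  refine (idist_le_pathLength h).trans
    ((pathLength_le_of_norm_le h intervalIntegrable_const fun t ht => ?_).trans_eq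
      (by simp : ∫ _ in (0 : ℝ)..1, ‖X‖ = ‖X‖))
  have hd : HasDerivAt (fun s : ℝ => U * NormedSpace.exp (s • X))
      (U * (NormedSpace.exp (t • X) * X)) t :=
    (hasDerivAt_exp_smul_const X t).const_mul U
  rw [hd.hasDerivWithinAt.derivWithin (uniqueDiffOn_Icc zero_lt_one t ht),
    norm_mul_of_mem_unitary hU, norm_mul_of_mem_unitary
      (exp_mem_unitary_of_star_eq_neg (star_real_smul_eq_neg hX t))]

theorem infinite_circle : Infinite Circle := by
  have h1 : (Circle.exp '' Set.Ioc (-Real.pi) Real.pi).Infinite :=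
    (Set.Ioc_infinite (by linarith [Real.pi_pos])).image Circle.invOn_arg_exp.1.injOn
  exact Set.infinite_univ_iff.1 (h1.mono (Set.subset_univ _))

/-- A matrix has finitely many eigenvalues, so some phase rotates all of them away from -1. -/
theorem exists_circle_smul_norm_sub_one_lt {U : 𝐌} (hU : U ∈ unitary 𝐌) :
    ∃ φ : Circle, ‖(φ : ℂ) • U - 1‖ < 2 := by
  have hinf := infinite_circle
  have hfin : {φ : Circle | -((φ⁻¹ : Circle) : ℂ) ∈ spectrum ℂ U}.Finite :=
    (Matrix.finite_spectrum U).preimage fun φ _ ψ _ h =>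
      Circle.ext (by simpa using h)
  obtain ⟨φ, hφ⟩ := hfin.infinite_compl.nonempty
  refine ⟨φ, (Unitary.norm_sub_one_lt_two_iff (circle_smul_mem_unitary φ hU)).2 fun hm => hφ ?_⟩
  have e : Units.mk0 (φ : ℂ) φ.coe_ne_zero • -((φ⁻¹ : Circle) : ℂ) = -1 := by
    rw [Units.smul_def, Units.val_mk0, smul_eq_mul, mul_neg, ← Circle.coe_mul, mul_inv_cancel,
      Circle.coe_one]
  refine (spectrum.smul_mem_smul_iff (a := U) (r := Units.mk0 (φ : ℂ) φ.coe_ne_zero)).1 ?_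
  rw [e]
  exact hm

theorem circle_exp_smul_exp (a : ℝ) (X : 𝐌) :
    (Circle.exp a : ℂ) • NormedSpace.exp X =
      NormedSpace.exp (((a : ℂ) * Complex.I) • (1 : 𝐌) + X) := by
  let +nondep : NormedAlgebra ℚ 𝐌 := .restrictScalars ℚ ℂ 𝐌
  have h : NormedSpace.exp (((a : ℂ) * Complex.I) • (1 : 𝐌)) = (Circle.exp a : ℂ) • (1 : 𝐌) := by
    rw [← Algebra.algebraMap_eq_smul_one, ← NormedSpace.algebraMap_exp_comm,
      Algebra.algebraMap_eq_smul_one, Circle.coe_exp, Complex.exp_eq_exp_ℂ]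
  rw [NormedSpace.exp_add_of_commute ((Commute.one_left X).smul_left _), h, smul_one_mul]

theorem star_phase (a : ℝ) : star (((a : ℂ) * Complex.I) • (1 : 𝐌)) =
    -(((a : ℂ) * Complex.I) • (1 : 𝐌)) := by
  rw [star_smul, star_one, ← neg_smul]; simp

theorem norm_sub_eq_norm_star_mul_sub_one {U V : 𝐌} (hU : U ∈ unitary 𝐌) :
    ‖star U * V - 1‖ = ‖U - V‖ := by
  rw [← norm_mul_of_mem_unitary hU, mul_sub, ← mul_assoc, (Unitary.mem_iff.1 hU).2, one_mul,
    mul_one, norm_sub_rev]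

theorem mul_star_mul_cancel {U : 𝐌} (hU : U ∈ unitary 𝐌) (V : 𝐌) : U * (star U * V) = V := by
  rw [← mul_assoc, (Unitary.mem_iff.1 hU).2, one_mul]

/-- Without a path, the infimum in `idist` would range over the empty set and take the value 0. A
phase makes the logarithm of `U† V` available, and it is absorbed into the exponent as a scalar. -/
theorem exists_isSmoothPath {U V : 𝐌} (hU : U ∈ unitary 𝐌) (hV : V ∈ unitary 𝐌) :
    ∃ γ, IsSmoothPath U V γ := by
  have hW : star U * V ∈ unitary 𝐌 := mul_mem (Unitary.star_mem hU) hV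
  obtain ⟨φ, hφ⟩ := exists_circle_smul_norm_sub_one_lt hW
  obtain ⟨X, hX, -, hXe⟩ := exists_exp_eq_of_norm_sub_one_lt (circle_smul_mem_unitary φ hW) hφ
  obtain ⟨a, ha⟩ := Circle.exp_surjective φ⁻¹
  have hV' : V = U * NormedSpace.exp (((a : ℂ) * Complex.I) • (1 : 𝐌) + X) := by
    rw [← circle_exp_smul_exp, ha, hXe, circle_inv_smul_smul, mul_star_mul_cancel hU]
  rw [hV']
  exact ⟨_, isSmoothPath_mul_exp hU (by rw [star_add, star_phase, hX, neg_add])⟩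

theorem exists_isSmoothPath_pathLength_lt {U V : 𝐌} (hU : U ∈ unitary 𝐌) (hV : V ∈ unitary 𝐌)
    {a : ℝ} (h : idist U V < a) : ∃ γ, IsSmoothPath U V γ ∧ pathLength γ < a := by
  obtain ⟨γ₀, h₀⟩ := exists_isSmoothPath hU hV
  obtain ⟨_, ⟨γ, hγ, rfl⟩, hlt⟩ := exists_lt_of_csInf_lt (s := {l : ℝ | ∃ γ, IsSmoothPath U V γ ∧
    l = pathLength γ}) ⟨_, γ₀, h₀, rfl⟩ h
  exact ⟨γ, hγ, hlt⟩

theorem norm_sub_le_idist {U V : 𝐌} (hU : U ∈ unitary 𝐌) (hV : V ∈ unitary 𝐌) :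
    ‖U - V‖ ≤ idist U V := by
  refine le_of_forall_gt fun a ha => ?_
  obtain ⟨γ, hγ, hlt⟩ := exists_isSmoothPath_pathLength_lt hU hV ha
  exact (norm_sub_le_pathLength hγ).trans_lt hlt

theorem idist_le_of_norm_sub_lt {U V : 𝐌} (hU : U ∈ unitary 𝐌) (hV : V ∈ unitary 𝐌)
    (h : ‖U - V‖ < 2) : idist U V ≤ Real.pi / 2 * ‖U - V‖ := by
  rw [← norm_sub_eq_norm_star_mul_sub_one hU] at h ⊢
  obtain ⟨X, hX, hXn, hXe⟩ :=
    exists_exp_eq_of_norm_sub_one_lt (mul_mem (Unitary.star_mem hU) hV) h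
  refine le_trans ?_ hXn
  have := idist_mul_exp_le hU hX
  rwa [hXe, mul_star_mul_cancel hU] at this

/-- Paths are multiplied pointwise instead of being concatenated. -/
theorem idist_triangle {U V W : 𝐌} (hU : U ∈ unitary 𝐌) (hV : V ∈ unitary 𝐌)
    (hW : W ∈ unitary 𝐌) : idist U W ≤ idist U V + idist V W := by
  refine le_of_forall_pos_lt_add fun ε hε => ?_
  obtain ⟨γ₁, h₁, hl₁⟩ := exists_isSmoothPath_pathLength_lt hU hV
    (lt_add_of_pos_right _ (half_pos hε))
  obtain ⟨γ₂, h₂, hl₂⟩ := exists_isSmoothPath_pathLength_lt hV hW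
    (lt_add_of_pos_right _ (half_pos hε))
  have hV1 : star V * V = 1 := (Unitary.mem_iff.1 hV).1
  have hpath : IsSmoothPath U W (fun t => γ₁ t * star V * γ₂ t) :=
    { smooth := (h₁.smooth.mul contDiffOn_const).mul h₂.smooth
      unitary := fun t ht => mul_mem (mul_mem (h₁.unitary t ht) (Unitary.star_mem hV))
        (h₂.unitary t ht)
      source := by rw [h₁.source, h₂.source, mul_assoc, hV1, mul_one]
      target := by rw [h₁.target, h₂.target, mul_assoc, mul_star_mul_cancel hV] }
  have hle := pathLength_le_of_norm_le hpath (h₁.intervalIntegrable.add h₂.intervalIntegrable)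
    fun t ht => by
      have hd : HasDerivWithinAt (fun t => γ₁ t * star V * γ₂ t) _ (Set.Icc 0 1) t :=
        ((h₁.hasDerivWithinAt ht).mul_const (star V)).mul (h₂.hasDerivWithinAt ht)
      rw [hd.derivWithin (uniqueDiffOn_Icc zero_lt_one t ht)]
      refine (norm_add_le _ _).trans_eq ?_
      rw [norm_mul_of_mem_unitary_right (h₂.unitary t ht),
        norm_mul_of_mem_unitary_right (Unitary.star_mem hV),
        norm_mul_of_mem_unitary (mul_mem (h₁.unitary t ht) (Unitary.star_mem hV))]
  have hsum : ∫ t in (0 : ℝ)..1, (‖derivWithin γ₁ (Set.Icc 0 1) t‖ +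
      ‖derivWithin γ₂ (Set.Icc 0 1) t‖) = pathLength γ₁ + pathLength γ₂ :=
    intervalIntegral.integral_add h₁.intervalIntegrable h₂.intervalIntegrable
  have := (idist_le_pathLength hpath).trans (hle.trans_eq hsum)
  linarith

/-- The map `W ↦ U W† V` is an isometry that exchanges `U` and `V`, so no reversal of time is
needed. -/
theorem idist_comm_le {U V : 𝐌} (hU : U ∈ unitary 𝐌) (hV : V ∈ unitary 𝐌) :
    idist V U ≤ idist U V := by
  refine le_of_forall_gt fun a ha => ?_
  obtain ⟨γ, hγ, hlt⟩ := exists_isSmoothPath_pathLength_lt hU hV ha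
  have hpath : IsSmoothPath V U (fun t => U * star (γ t) * V) :=
    { smooth := (contDiffOn_const.mul
        ((starL' ℝ : 𝐌 ≃L[ℝ] 𝐌).contDiff.comp_contDiffOn hγ.smooth)).mul contDiffOn_const
      unitary := fun t ht => mul_mem (mul_mem hU (Unitary.star_mem (hγ.unitary t ht))) hV
      source := by rw [hγ.source, (Unitary.mem_iff.1 hU).2, one_mul]
      target := by rw [hγ.target, mul_assoc, (Unitary.mem_iff.1 hV).1, mul_one] }
  refine (idist_le_pathLength hpath).trans_lt (lt_of_le_of_lt ?_ hlt)
  refine pathLength_le_of_norm_le hpath hγ.intervalIntegrable fun t ht => ?_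
  have hd := ((hγ.hasDerivWithinAt ht).star.const_mul U).mul_const V
  rw [hd.derivWithin (uniqueDiffOn_Icc zero_lt_one t ht), norm_mul_of_mem_unitary_right hV,
    norm_mul_of_mem_unitary hU, norm_star]

theorem idist_comm {U V : 𝐌} (hU : U ∈ unitary 𝐌) (hV : V ∈ unitary 𝐌) :
    idist U V = idist V U :=
  le_antisymm (idist_comm_le hV hU) (idist_comm_le hU hV)

theorem idist_mul_mul_le {A B U V : 𝐌} (hA : A ∈ unitary 𝐌) (hB : B ∈ unitary 𝐌)
    (hU : U ∈ unitary 𝐌) (hV : V ∈ unitary 𝐌) : idist (A * U * B) (A * V * B) ≤ idist U V := by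
  refine le_of_forall_gt fun a ha => ?_
  obtain ⟨γ, hγ, hlt⟩ := exists_isSmoothPath_pathLength_lt hU hV ha
  have hpath : IsSmoothPath (A * U * B) (A * V * B) (fun t => A * γ t * B) :=
    { smooth := (contDiffOn_const.mul hγ.smooth).mul contDiffOn_const
      unitary := fun t ht => mul_mem (mul_mem hA (hγ.unitary t ht)) hB
      source := by rw [hγ.source]
      target := by rw [hγ.target] }
  refine (idist_le_pathLength hpath).trans_lt (lt_of_le_of_lt ?_ hlt)
  refine pathLength_le_of_norm_le hpath hγ.intervalIntegrable fun t ht => ?_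
  have hd := ((hγ.hasDerivWithinAt ht).const_mul A).mul_const B
  rw [hd.derivWithin (uniqueDiffOn_Icc zero_lt_one t ht), norm_mul_of_mem_unitary_right hB,
    norm_mul_of_mem_unitary hA]

theorem idist_smul_smul_le {U V : 𝐌} (φ : Circle) (hU : U ∈ unitary 𝐌) (hV : V ∈ unitary 𝐌) :
    idist ((φ : ℂ) • U) ((φ : ℂ) • V) ≤ idist U V := by
  simpa using idist_mul_mul_le (circle_smul_mem_unitary φ (one_mem _)) (one_mem _) hU hV

/-! ### The projective metric -/

theorem bddBelow_range_idist (U V : 𝐌) :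
    BddBelow (Set.range fun φ : Circle => idist U ((φ : ℂ) • V)) :=
  ⟨0, by rintro _ ⟨φ, rfl⟩; exact idist_nonneg _ _⟩

theorem pdist_nonneg (U V : 𝐌) : 0 ≤ pdist U V := le_ciInf fun _ => idist_nonneg _ _

theorem pdist_le_idist_smul (U V : 𝐌) (φ : Circle) : pdist U V ≤ idist U ((φ : ℂ) • V) :=
  ciInf_le (bddBelow_range_idist U V) φ

theorem pdist_le_idist (U V : 𝐌) : pdist U V ≤ idist U V := by
  simpa using pdist_le_idist_smul U V 1

theorem exists_idist_lt_of_pdist_lt {U V : 𝐌} {a : ℝ} (h : pdist U V < a) :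
    ∃ φ : Circle, idist U ((φ : ℂ) • V) < a := exists_lt_of_ciInf_lt h

theorem pdist_smul_right (U V : 𝐌) (φ : Circle) : pdist U ((φ : ℂ) • V) = pdist U V := by
  refine le_antisymm (le_ciInf fun ψ => ?_) (le_ciInf fun ψ => ?_)
  · refine (pdist_le_idist_smul _ _ (ψ * φ⁻¹)).trans_eq ?_
    rw [Circle.coe_mul, mul_smul, circle_inv_smul_smul]
  · rw [smul_smul, ← Circle.coe_mul]
    exact pdist_le_idist_smul _ _ _

theorem pdist_triangle {U V W : 𝐌} (hU : U ∈ unitary 𝐌) (hV : V ∈ unitary 𝐌)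
    (hW : W ∈ unitary 𝐌) : pdist U W ≤ pdist U V + pdist V W := by
  refine le_of_forall_pos_lt_add fun ε hε => ?_
  obtain ⟨φ, hφ⟩ := exists_idist_lt_of_pdist_lt (lt_add_of_pos_right (pdist U V) (half_pos hε))
  obtain ⟨ψ, hψ⟩ := exists_idist_lt_of_pdist_lt (lt_add_of_pos_right (pdist V W) (half_pos hε))
  have hψW := circle_smul_mem_unitary ψ hW
  have h1 := pdist_le_idist_smul U W (φ * ψ)
  rw [Circle.coe_mul, mul_smul] at h1
  have h2 := idist_triangle hU (circle_smul_mem_unitary φ hV) (circle_smul_mem_unitary φ hψW)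
  have h3 := idist_smul_smul_le φ hV hψW
  linarith

theorem pdist_comm_le {U V : 𝐌} (hU : U ∈ unitary 𝐌) (hV : V ∈ unitary 𝐌) :
    pdist V U ≤ pdist U V := by
  refine le_ciInf fun φ => ?_
  have hφ := circle_smul_mem_unitary φ hV
  have h1 := idist_smul_smul_le φ⁻¹ hφ hU
  rw [circle_inv_smul_smul, ← idist_comm hU hφ] at h1
  exact (pdist_le_idist_smul _ _ _).trans h1

theorem pdist_comm {U V : 𝐌} (hU : U ∈ unitary 𝐌) (hV : V ∈ unitary 𝐌) :
    pdist U V = pdist V U :=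
  le_antisymm (pdist_comm_le hV hU) (pdist_comm_le hU hV)

theorem pdist_mul_right_le {U V B : 𝐌} (hB : B ∈ unitary 𝐌) (hU : U ∈ unitary 𝐌)
    (hV : V ∈ unitary 𝐌) : pdist (U * B) (V * B) ≤ pdist U V := by
  refine le_ciInf fun φ => (pdist_le_idist_smul _ _ φ).trans ?_
  simpa using idist_mul_mul_le (one_mem _) hB hU (circle_smul_mem_unitary φ hV)

theorem pdist_le_pi {U V : 𝐌} (hU : U ∈ unitary 𝐌) (hV : V ∈ unitary 𝐌) :
    pdist U V ≤ Real.pi := by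
  obtain ⟨φ, hφ⟩ := exists_circle_smul_norm_sub_one_lt (mul_mem (Unitary.star_mem hU) hV)
  rw [← mul_smul_comm, norm_sub_eq_norm_star_mul_sub_one hU] at hφ
  refine (pdist_le_idist_smul U V φ).trans
    ((idist_le_of_norm_sub_lt hU (circle_smul_mem_unitary φ hV) hφ).trans ?_)
  nlinarith [Real.pi_pos]

theorem pdist_exp_mul_le {U V X : 𝐌} (hU : U ∈ unitary 𝐌) (hV : V ∈ unitary 𝐌)
    (hX : star X = -X) : pdist U (NormedSpace.exp X * V) ≤ pdist U V + ‖X‖ := by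
  have he := exp_mem_unitary_of_star_eq_neg hX
  have h1 := pdist_triangle hU hV (mul_mem he hV)
  have h2 := pdist_mul_right_le hV (one_mem _) he
  have h3 := (pdist_le_idist 1 (NormedSpace.exp X)).trans
    ((congrArg _ (one_mul _).symm).trans_le (idist_mul_exp_le (one_mem _) hX))
  rw [one_mul] at h2
  linarith

theorem continuous_pdist :
    Continuous fun x : UU d × UU d => pdist (x.1 : 𝐌) (x.2 : 𝐌) := by
  rw [continuous_iff_continuousAt]
  rintro ⟨U, V⟩
  have h0 : Filter.Tendsto (fun x : UU d × UU d => Real.pi / 2 * ‖(U : 𝐌) - x.1‖ +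
      Real.pi / 2 * ‖(V : 𝐌) - x.2‖) (nhds (U, V)) (nhds 0) := by
    have : Continuous (fun x : UU d × UU d => Real.pi / 2 * ‖(U : 𝐌) - x.1‖ +
      Real.pi / 2 * ‖(V : 𝐌) - x.2‖) := by fun_prop
    simpa using this.tendsto (U, V)
  have hev : ∀ W : UU d, ∀ᶠ x : UU d in nhds W, ‖(W : 𝐌) - x‖ < 2 := fun W => by
    have : Continuous (fun x : UU d => ‖(W : 𝐌) - x‖) := by fun_prop
    exact (this.tendsto W).eventually_lt_const (by simp)
  refine tendsto_iff_norm_sub_tendsto_zero.2 (squeeze_zero' (.of_forall fun _ => norm_nonneg _)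
    ?_ h0)
  filter_upwards [(continuous_fst.tendsto (U, V)).eventually (hev U),
    (continuous_snd.tendsto (U, V)).eventually (hev V)] with x hx₁ hx₂
  have hU := coe_mem_unitary U
  have hV := coe_mem_unitary V
  have h1 := coe_mem_unitary x.1
  have h2 := coe_mem_unitary x.2
  have d1 := (pdist_le_idist _ _).trans (idist_le_of_norm_sub_lt hU h1 hx₁)
  have d2 := (pdist_le_idist _ _).trans (idist_le_of_norm_sub_lt hV h2 hx₂)
  have t1 := pdist_triangle hU h1 hV
  have t2 := pdist_triangle h1 h2 hV
  have t3 := pdist_triangle h1 hU h2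
  have t4 := pdist_triangle hU hV h2
  rw [pdist_comm h2 hV] at t2
  rw [pdist_comm h1 hU] at t3
  rw [Real.norm_eq_abs, abs_le]
  constructor <;> linarith

theorem measurable_pdist : Measurable fun x : UU d × UU d => pdist (x.1 : 𝐌) (x.2 : 𝐌) :=
  continuous_pdist.measurable

end Metric
end Tomography

namespace Tomography

/-! ### One round of the bootstrap -/

section Round

variable {d : ℕ}

local notation "𝐌" => Matrix (Fin d) (Fin d) ℂ

/-- The logarithm of the chosen representative has norm below `π`. This holds for any `U`, however
inaccurate, and controls the damage of bad rounds. -/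
theorem pdist_projRoot_mul_le {Z U V W : 𝐌} (hZ : Z ∈ unitary 𝐌) (hV : V ∈ unitary 𝐌) {p : ℕ}
    (hW : IsProjRoot p U W) : pdist Z (W * V) ≤ pdist Z V + Real.pi / p := by
  obtain ⟨φ, -, X, hX, hXn, -, rfl⟩ := hW
  have h := pdist_exp_mul_le hZ hV (star_real_smul_eq_neg (X := X) hX (1 / (p : ℝ)))
  refine h.trans ((add_le_add_iff_left _).2 ?_)
  rw [norm_smul, Real.norm_of_nonneg (by positivity), one_div, inv_mul_eq_div]
  gcongr

theorem pdist_projRoot_one (Z : 𝐌) {U W : 𝐌} (hW : IsProjRoot 1 U W) :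
    pdist Z W = pdist Z U := by
  obtain ⟨φ, -, X, -, -, hXe, rfl⟩ := hW
  rw [Nat.cast_one, div_one, one_smul, hXe, pdist_smul_right]

theorem one_div_three_pi_bounds :
    (0.106 : ℝ) < 1 / (3 * Real.pi) ∧ 1 / (3 * Real.pi) < (0.1062 : ℝ) := by
  have h1 := Real.pi_gt_d4
  have h2 := Real.pi_lt_d4
  constructor
  · rw [lt_div_iff₀ (by positivity)]; linarith
  · rw [div_lt_iff₀ (by positivity)]; linarith

/-- The radius `1 / (3π)` times the factor `π / 2` of the logarithm is 1/6, small enough for the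
Lipschitz estimate. -/
theorem norm_le_of_idist_one_exp_lt {Y : 𝐌} (hY : star Y = -Y) (hYn : ‖Y‖ < Real.pi)
    (h : idist 1 (NormedSpace.exp Y) < 1 / (3 * Real.pi)) :
    ‖NormedSpace.exp Y - 1‖ ≤ 0.1062 ∧ ‖Y‖ ≤ 1 / 6 := by
  have h1 := (norm_sub_le_idist (one_mem _) (exp_mem_unitary_of_star_eq_neg hY)).trans_lt h
  rw [norm_sub_rev] at h1
  refine ⟨(h1.trans one_div_three_pi_bounds.2).le, ?_⟩
  have hpi := Real.pi_pos
  calc ‖Y‖ ≤ Real.pi / 2 * ‖NormedSpace.exp Y - 1‖ :=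
        norm_le_half_pi_mul_norm_exp_sub_one hY hYn.le
    _ ≤ Real.pi / 2 * (1 / (3 * Real.pi)) := by gcongr
    _ = 1 / 6 := by field_simp; norm_num

/-- A phase that nearly aligns two unitaries near the identity has a small logarithm, so that
their logarithms are aligned as well. -/
theorem exists_phase_log {X Y : 𝐌} (hX : star X = -X) (hY : star Y = -Y) (hXn : ‖X‖ ≤ 0.063)
    (hYn : ‖Y‖ ≤ 1 / 6) (hYe : ‖NormedSpace.exp Y - 1‖ ≤ 0.1062)
    (h : pdist (NormedSpace.exp Y) (NormedSpace.exp X) < 0.0051) :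
    ∃ a : ℝ, ‖((a : ℂ) * Complex.I) • (1 : 𝐌) + X - Y‖ ≤ 0.01134 := by
  have hXu := exp_mem_unitary_of_star_eq_neg hX
  obtain ⟨χ, hχ⟩ := exists_idist_lt_of_pdist_lt h
  have hχ' := (norm_sub_le_idist (exp_mem_unitary_of_star_eq_neg hY)
    (circle_smul_mem_unitary χ hXu)).trans_lt hχ
  set a : ℝ := Complex.arg (χ : ℂ) with ha
  have haχ : Circle.exp a = χ := Circle.exp_arg χ
  set P : 𝐌 := ((a : ℂ) * Complex.I) • (1 : 𝐌) with hP
  have hPs : star P = -P := star_phase a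
  have hPe : NormedSpace.exp P = (χ : ℂ) • (1 : 𝐌) := by
    have := circle_exp_smul_exp a (0 : 𝐌)
    rw [NormedSpace.exp_zero, add_zero, haχ] at this
    exact this.symm
  -- Here `d = 0` is not excluded, and then the identity has norm 0.
  have hone : ‖(1 : 𝐌)‖ ≤ 1 := by
    rcases subsingleton_or_nontrivial 𝐌 with h | h
    · rw [Subsingleton.elim (1 : 𝐌) 0, norm_zero]; exact zero_le_one
    · exact CStarRing.norm_one.le
  have hPn : ‖P‖ ≤ Real.pi := by
    rw [hP, norm_smul]
    refine (mul_le_of_le_one_right (norm_nonneg _) hone).trans ?_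
    simpa using Complex.abs_arg_le_pi (χ : ℂ)
  -- Both exponentials are near 1 and `χ` nearly aligns them, so `χ` itself is near 1 and its
  -- principal argument is small.
  have h1 : ‖NormedSpace.exp P - 1‖ ≤ 0.063 + 0.0051 + 0.1062 := by
    have e : NormedSpace.exp P - 1 = -((χ : ℂ) • (NormedSpace.exp X - 1)) +
        -(NormedSpace.exp Y - (χ : ℂ) • NormedSpace.exp X) + (NormedSpace.exp Y - 1) := by
      rw [hPe, smul_sub]; abel
    have h2 : ‖-((χ : ℂ) • (NormedSpace.exp X - 1))‖ ≤ 0.063 := by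
      rw [norm_neg, norm_smul, Circle.norm_coe, one_mul]
      exact (norm_exp_sub_one_le hX).trans hXn
    rw [e]
    refine (norm_add₃_le).trans ?_
    rw [norm_neg (NormedSpace.exp Y - _)]
    linarith
  have h2 : ‖P‖ ≤ 0.2739 := by
    have := norm_le_half_pi_mul_norm_exp_sub_one hPs hPn
    nlinarith [Real.pi_lt_d4, norm_nonneg (NormedSpace.exp P - 1)]
  -- With `‖Y‖ ≤ 1/6` the total stays below 11/20. The Lipschitz bound then gives `20/9 · 0.0051 <
  -- 0.01134`.
  have hsum : ‖P + X‖ ≤ 0.3369 := (norm_add_le _ _).trans (by linarith)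
  refine ⟨a, ?_⟩
  have h3 := norm_sub_le_of_norm_add_norm_le (X := P + X) (Y := Y)
    (by rw [star_add, hPs, hX, neg_add]) hY (by linarith)
  rw [hP, ← circle_exp_smul_exp, haχ, norm_sub_rev (_ • _)] at h3
  linarith

/-- The heart of the bootstrap: powers and roots act linearly on small logarithms, so a constant
error on the `p`-th power becomes an error of order `1 / p`, and the constant 0.04 is halved. -/
theorem pdist_projRoot_mul_lt {Z U V W : 𝐌} (hZ : Z ∈ unitary 𝐌) (hU : U ∈ unitary 𝐌)
    (hV : V ∈ unitary 𝐌) {p : ℕ} (hp : 1 ≤ p) (hZV : pdist Z V < 0.04 / p)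
    (hSU : pdist ((Z * star V) ^ p) U ≤ 1 / 200) (hW : IsProjRoot p U W) :
    pdist Z (W * V) < 0.02 / p := by
  have hp1 : (1 : ℝ) ≤ p := by exact_mod_cast hp
  have hp0 : (0 : ℝ) < p := by linarith
  have hpi0 := Real.pi_pos
  have hpi := Real.pi_lt_d4
  set S : 𝐌 := Z * star V with hSdef
  have hS : S ∈ unitary 𝐌 := mul_mem hZ (Unitary.star_mem hV)
  have hSV : S * V = Z := by rw [hSdef, mul_assoc, (Unitary.mem_iff.1 hV).1, mul_one]
  obtain ⟨ψ, hψ⟩ := exists_idist_lt_of_pdist_lt hZV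
  have hψ' := (norm_sub_le_idist hZ (circle_smul_mem_unitary ψ hV)).trans_lt hψ
  set G : 𝐌 := ((ψ⁻¹ : Circle) : ℂ) • S with hG
  have hGu : G ∈ unitary 𝐌 := circle_smul_mem_unitary _ hS
  have hGn : ‖G - 1‖ < 0.04 / p := by
    have e : G - 1 = ((ψ⁻¹ : Circle) : ℂ) • ((Z - (ψ : ℂ) • V) * star V) := by
      rw [sub_mul, smul_mul_assoc, (Unitary.mem_iff.1 hV).2, smul_sub, circle_inv_smul_smul]
    rwa [e, norm_smul, Circle.norm_coe, one_mul,
      norm_mul_of_mem_unitary_right (Unitary.star_mem hV)]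
  have hsmall : 0.04 / (p : ℝ) ≤ 0.04 := div_le_self (by norm_num) hp1
  obtain ⟨X, hX, hXn, hXe⟩ := exists_exp_eq_of_norm_sub_one_lt hGu (by linarith)
  have hpX : star ((p : ℝ) • X) = -((p : ℝ) • X) := star_real_smul_eq_neg hX _
  have hpXn : ‖(p : ℝ) • X‖ ≤ 0.063 := by
    rw [norm_smul, Real.norm_of_nonneg hp0.le]
    have h1 : (p : ℝ) * ‖G - 1‖ ≤ 0.04 := by
      rw [lt_div_iff₀ hp0] at hGn; linarith
    have h2 : (p : ℝ) * ‖X‖ ≤ p * (Real.pi / 2 * ‖G - 1‖) := by gcongr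
    have h3 : Real.pi / 2 * (p * ‖G - 1‖) ≤ Real.pi / 2 * 0.04 := by gcongr
    linarith
  have hpXe : NormedSpace.exp ((p : ℝ) • X) = (((ψ⁻¹ ^ p : Circle)) : ℂ) • S ^ p := by
    let +nondep : NormedAlgebra ℚ 𝐌 := .restrictScalars ℚ ℂ 𝐌
    rw [Nat.cast_smul_eq_nsmul, NormedSpace.exp_nsmul, hXe, hG, smul_pow, Circle.coe_pow]
  have hSp : S ^ p ∈ unitary 𝐌 := pow_mem hS p
  -- Since `0.063 + 0.005 < 0.106`, the class of `U` meets the ball around the identity, so the root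
  -- rule must choose a representative there and hence the right branch.
  have h1U : pdist 1 U < 1 / (3 * Real.pi) := by
    have h1 := pdist_triangle (one_mem _) hSp hU
    have h2 : pdist 1 (S ^ p) ≤ 0.063 := by
      rw [← pdist_smul_right _ _ (ψ⁻¹ ^ p), ← hpXe]
      refine (pdist_le_idist _ _).trans (le_trans ?_ hpXn)
      simpa using idist_mul_exp_le (one_mem (unitary 𝐌)) hpX
    have := one_div_three_pi_bounds.1
    linarith
  obtain ⟨ν, hν, Y, hY, hYn, hYe, rfl⟩ := hW
  have hY : star Y = -Y := hY
  have hν := hν h1U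
  rw [← hYe] at hν
  obtain ⟨hY1, hY2⟩ := norm_le_of_idist_one_exp_lt hY hYn hν
  obtain ⟨a, ha⟩ := exists_phase_log hpX hY hpXn hY2 hY1 (by
    rw [hpXe, pdist_smul_right, pdist_comm (exp_mem_unitary_of_star_eq_neg hY) hSp, hYe,
      pdist_smul_right]
    linarith)
  have hXp : star ((((a / p : ℝ) : ℂ) * Complex.I) • (1 : 𝐌) + X) =
      -((((a / p : ℝ) : ℂ) * Complex.I) • (1 : 𝐌) + X) := by
    rw [star_add, star_phase, hX, neg_add]
  have hYp := star_real_smul_eq_neg hY (1 / (p : ℝ))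
  -- The unknown phase `a` turns into the phase `a / p`, which the projective distance does not see.
  have hdiff : ‖(1 / (p : ℝ)) • Y - ((((a / p : ℝ) : ℂ) * Complex.I) • (1 : 𝐌) + X)‖ ≤
      0.01134 / p := by
    have e : ((((a / p : ℝ) : ℂ) * Complex.I) • (1 : 𝐌) + X) - (1 / (p : ℝ)) • Y =
        (1 / (p : ℝ)) • (((a : ℂ) * Complex.I) • (1 : 𝐌) + (p : ℝ) • X - Y) := by
      rw [smul_sub, smul_add, smul_smul, one_div_mul_cancel hp0.ne', one_smul]
      congr 2
      rw [← Complex.coe_smul, smul_smul]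
      congr 1
      push_cast
      ring
    rw [norm_sub_rev, e, norm_smul, Real.norm_of_nonneg (by positivity), one_div, inv_mul_eq_div]
    gcongr
  have hexp := (norm_exp_sub_exp_le hYp hXp).trans hdiff
  have hYu := exp_mem_unitary_of_star_eq_neg hYp
  have hsmall' : 0.01134 / (p : ℝ) ≤ 0.01134 := div_le_self (by norm_num) hp1
  have hid := idist_le_of_norm_sub_lt hYu (exp_mem_unitary_of_star_eq_neg hXp) (by linarith)
  have hfin : pdist Z (NormedSpace.exp ((1 / (p : ℝ)) • Y) * V) ≤ Real.pi / 2 * (0.01134 / p) := by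
    have h1 := pdist_mul_right_le hV hS hYu
    rw [hSV] at h1
    refine h1.trans ?_
    rw [pdist_comm hS hYu, ← pdist_smul_right _ _ (Circle.exp (a / p) * ψ⁻¹), Circle.coe_mul,
      mul_smul, ← hG, ← hXe, circle_exp_smul_exp]
    exact (pdist_le_idist _ _).trans (hid.trans (by gcongr))
  refine hfin.trans_lt ?_
  rw [← mul_div_assoc]
  gcongr
  linarith

end Round
end Tomography

namespace Tomography

/-! ### Output distributions of programs -/

namespace Prog

open scoped ComplexOrder

variable {d k : ℕ}

theorem trace_sum_kraus {m : ℕ} {K : Fin m → Op d k} (hK : ∑ i, (K i)ᴴ * K i = 1) (ρ : Op d k) :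
    ∑ i, (K i * ρ * (K i)ᴴ).trace = ρ.trace := by
  have h : ∀ i, (K i * ρ * (K i)ᴴ).trace = ((K i)ᴴ * K i * ρ).trace := fun i => by
    rw [Matrix.trace_mul_comm, mul_assoc]
  rw [Finset.sum_congr rfl fun i _ => h i, ← Matrix.trace_sum, ← Finset.sum_mul, hK, one_mul]

theorem trace_re_nonneg {n : Type*} [Fintype n] {ρ : Matrix n n ℂ} (hρ : ρ.PosSemidef) :
    0 ≤ ρ.trace.re := (Complex.le_def.1 hρ.trace_nonneg).1

theorem trace_conj_onQudit (Z : UU d) (ρ : Op d k) :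
    (onQudit k Z * ρ * (onQudit k Z)ᴴ).trace = ρ.trace := by
  rw [Matrix.trace_mul_comm, ← mul_assoc, onQudit_isometry, one_mul]

theorem run_univ (Z : UU d) (P : Prog d k) {ρ : Op d k} (hρ : ρ.PosSemidef) :
    P.run Z ρ Set.univ = ENNReal.ofReal ρ.trace.re := by
  induction P generalizing ρ with
  | output U => simp [run]
  | query next ih => rw [run, ih (hρ.mul_mul_conjTranspose_same _), trace_conj_onQudit]
  | instrument K hK next ih =>
    rw [run, Measure.finsetSum_apply,
      Finset.sum_congr rfl fun i _ => ih i (hρ.mul_mul_conjTranspose_same (K i)),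
      ← ENNReal.ofReal_sum_of_nonneg fun i _ =>
        trace_re_nonneg (hρ.mul_mul_conjTranspose_same (K i)),
      ← Complex.re_sum, trace_sum_kraus hK]

theorem run_smul (Z : UU d) (P : Prog d k) {c : ℝ} (hc : 0 ≤ c) (ρ : Op d k) :
    P.run Z (c • ρ) = ENNReal.ofReal c • P.run Z ρ := by
  induction P generalizing ρ with
  | output U =>
    rw [run, run, smul_smul, ← ENNReal.ofReal_mul hc, Matrix.trace_smul, Complex.smul_re,
      smul_eq_mul]
  | query next ih => rw [run, run, mul_smul_comm, smul_mul_assoc, ih]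
  | instrument K hK next ih =>
    simp only [run, mul_smul_comm, smul_mul_assoc, ih, Finset.smul_sum]

theorem initial_posSemidef [NeZero d] : (initial d k).PosSemidef := by
  have h : initial d k = Matrix.single (0, 0) (0, 0) 1 * (Matrix.single (0, 0) (0, 0) 1)ᴴ := by
    simp [initial, Matrix.conjTranspose_single]
  rw [h]
  exact Matrix.posSemidef_self_mul_conjTranspose _

theorem trace_initial [NeZero d] : (initial d k).trace = 1 := by
  simp [initial, Matrix.trace_single_eq_same]

instance [NeZero d] (P : Prog d k) (Z : UU d) : IsProbabilityMeasure (P.out Z) :=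
  ⟨by rw [out, run_univ Z P initial_posSemidef, trace_initial]; simp⟩

/-- Each Kraus operator leaves a diagonal entry of `ρ` times the initial state, so only the trace of
`ρ` survives. This makes consecutive runs independent. -/
theorem run_reset [NeZero d] (Z : UU d) (P : Prog d k) {ρ : Op d k} (hρ : ρ.PosSemidef) :
    (reset P).run Z ρ = ENNReal.ofReal ρ.trace.re • P.out Z := by
  have h : ∀ i, resetKraus d k i * ρ * (resetKraus d k i)ᴴ =
      (fun x : Reg d k => (ρ x x).re • initial d k) (finProdFinEquiv.symm i) := fun i => by
    have hre : ∀ x, ρ x x = ((ρ x x).re : ℂ) := fun x =>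
      (Complex.eq_re_of_ofReal_le (hρ.diag_nonneg (i := x)))
    simp only [resetKraus, Matrix.conjTranspose_single, star_one, initial,
      Matrix.single_mul_mul_single, one_mul, mul_one]
    rw [Matrix.smul_single]
    congr 1
    rw [Complex.real_smul, mul_one]
    exact hre _
  have h0 : ∀ x : Reg d k, 0 ≤ (ρ x x).re := fun x =>
    (Complex.le_def.1 (hρ.diag_nonneg (i := x))).1
  rw [reset, run, Finset.sum_congr rfl fun i _ => by rw [h i]]
  rw [Equiv.sum_comp finProdFinEquiv.symm fun x : Reg d k => P.run Z ((ρ x x).re • initial d k),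
    Finset.sum_congr rfl fun x _ => run_smul Z P (h0 x) _, ← Finset.sum_smul,
    ← ENNReal.ofReal_sum_of_nonneg fun x _ => h0 x, ← Complex.re_sum]
  rfl

/-- A program has finitely many branches, so these integrals are finite sums and neither `g` nor `F`
has to be measurable. -/
theorem lintegral_run_bind [NeZero d] (Z : UU d) (g : UU d → Prog d k) (P : Prog d k) {ρ : Op d k}
    (hρ : ρ.PosSemidef) (F : UU d → ENNReal) :
    ∫⁻ U, F U ∂((P.bind g).run Z ρ) = ∫⁻ U, ∫⁻ W, F W ∂((g U).out Z) ∂(P.run Z ρ) := by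
  induction P generalizing ρ with
  | output U =>
    rw [bind, run_reset Z _ hρ, run, lintegral_smul_measure, lintegral_smul_measure,
      lintegral_dirac]
  | query next ih => exact ih (hρ.mul_mul_conjTranspose_same _)
  | instrument K hK next ih =>
    rw [bind, run, run, lintegral_finsetSum_measure, lintegral_finsetSum_measure]
    exact Finset.sum_congr rfl fun i _ => ih i (hρ.mul_mul_conjTranspose_same (K i))

theorem lintegral_out_bind [NeZero d] (Z : UU d) (g : UU d → Prog d k) (P : Prog d k)
    (F : UU d → ENNReal) :
    ∫⁻ U, F U ∂((P.bind g).out Z) = ∫⁻ U, ∫⁻ W, F W ∂((g U).out Z) ∂(P.out Z) :=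
  lintegral_run_bind Z g P initial_posSemidef F

theorem onQudit_mul (U V : UU d) : onQudit k (U * V) = onQudit k U * onQudit k V := by
  simp only [onQudit, Submonoid.coe_mul]
  rw [← Matrix.mul_kronecker_mul, mul_one]

theorem onQudit_one : onQudit k (1 : UU d) = 1 := by
  simp [onQudit]

theorem run_queryPow (Z V : UU d) (p : ℕ) (P : Prog d k) (ρ : Op d k) :
    (queryPow V p P).run Z ρ =
      P.run Z (onQudit k ((Z * V⁻¹) ^ p) * ρ * (onQudit k ((Z * V⁻¹) ^ p))ᴴ) := by
  induction p generalizing ρ with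
  | zero => simp [queryPow, onQudit_one]
  | succ p ih =>
    rw [queryPow, gate, run, Fin.sum_univ_one, run, ih, pow_succ, onQudit_mul, onQudit_mul]
    simp only [Matrix.conjTranspose_mul, mul_assoc]

theorem run_withOracle (Z V : UU d) (p : ℕ) (P : Prog d k) (ρ : Op d k) :
    (P.withOracle V p).run Z ρ = P.run ((Z * V⁻¹) ^ p) ρ := by
  induction P generalizing ρ with
  | output U => rfl
  | query next ih => rw [withOracle, run_queryPow, ih, run]
  | instrument K hK next ih => simp only [withOracle, run, ih]

theorem out_withOracle [NeZero d] (Z V : UU d) (p : ℕ) (P : Prog d k) :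
    (P.withOracle V p).out Z = P.out ((Z * V⁻¹) ^ p) := run_withOracle Z V p P _

theorem continuous_onQudit : Continuous (onQudit k : UU d → Op d k) := by
  refine continuous_matrix fun i j => ?_
  simp only [onQudit, Matrix.kroneckerMap_apply]
  exact (continuous_subtype_val.matrix_elem _ _).mul continuous_const

theorem continuous_run (P : Prog d k) (B : Set (UU d)) :
    Continuous fun x : UU d × Op d k => P.run x.1 x.2 B := by
  induction P with
  | output U =>
    simp only [run, Measure.smul_apply, smul_eq_mul]
    refine ENNReal.continuous_mul_const (measure_ne_top _ _) |>.comp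
      (ENNReal.continuous_ofReal.comp (Complex.continuous_re.comp ?_))
    exact continuous_snd.matrix_trace
  | query next ih =>
    have h : Continuous fun x : UU d × Op d k => onQudit k x.1 :=
      continuous_onQudit.comp continuous_fst
    exact ih.comp (continuous_fst.prodMk
      ((h.matrix_mul continuous_snd).matrix_mul h.matrix_conjTranspose))
  | instrument K hK next ih =>
    simp only [run, Measure.finsetSum_apply]
    refine continuous_finsetSum _ fun i _ => ?_
    have h : Continuous fun x : UU d × Op d k => K i * x.2 * (K i)ᴴ :=
      (continuous_const.matrix_mul continuous_snd).matrix_mul continuous_const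
    exact (ih i).comp (continuous_fst.prodMk h)

theorem continuous_out [NeZero d] (P : Prog d k) (B : Set (UU d)) :
    Continuous fun Z : UU d => P.out Z B :=
  (continuous_run P B).comp (continuous_id.prodMk continuous_const)

/-! ### Query counts -/

theorem queries_bind_le [NeZero d] (P : Prog d k) {g : UU d → Prog d k} {b : ℕ}
    (hg : ∀ U, (g U).queries ≤ b) : (P.bind g).queries ≤ P.queries + b := by
  induction P with
  | output U =>
    rw [bind, reset, queries]
    exact Finset.sup_le fun _ _ => (hg U).trans (Nat.le_add_left _ _)
  | query next ih => rw [bind, queries, queries]; omega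
  | instrument K hK next ih =>
    rw [bind, queries, queries]
    refine Finset.sup_le fun i _ => (ih i).trans (Nat.add_le_add_right ?_ _)
    exact Finset.le_sup (f := fun i => (next i).queries) (Finset.mem_univ i)

theorem queries_queryPow (V : UU d) (p : ℕ) (P : Prog d k) :
    (queryPow V p P).queries = p + P.queries := by
  induction p with
  | zero => simp [queryPow]
  | succ p ih => simp [queryPow, gate, queries, ih]; omega

theorem queries_withOracle_le (V : UU d) (p : ℕ) (P : Prog d k) :
    (P.withOracle V p).queries ≤ p * P.queries := by
  induction P with
  | output U => simp [withOracle, queries]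
  | query next ih => rw [withOracle, queries_queryPow, queries, Nat.mul_add]; omega
  | instrument K hK next ih =>
    rw [withOracle, queries, queries]
    refine Finset.sup_le fun i _ => (ih i).trans (Nat.mul_le_mul_left _ ?_)
    exact Finset.le_sup (f := fun i => (next i).queries) (Finset.mem_univ i)

theorem queries_runAll_le [NeZero d] {n : ℕ} (P : Fin n → Prog d k)
    (g : (Fin n → UU d) → Prog d k) {a b : ℕ} (hP : ∀ i, (P i).queries ≤ a)
    (hg : ∀ u, (g u).queries ≤ b) : (runAll P g).queries ≤ n * a + b := by
  induction n with
  | zero => simpa [runAll] using hg _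
  | succ n ih =>
    rw [runAll]
    refine (queries_bind_le (P 0) fun U => ih (Fin.tail P) _ (fun i => hP i.succ)
      fun u => hg _).trans ?_
    have := hP 0
    rw [Nat.succ_mul]; omega

end Prog
end Tomography

namespace Tomography

/-! ### Integrals over finite products -/

section Pi

theorem lintegral_pi_fin_succ {n : ℕ} {X : Fin (n + 1) → Type*} [∀ i, MeasurableSpace (X i)]
    (μ : ∀ i, Measure (X i)) [∀ i, SigmaFinite (μ i)] {f : (∀ i, X i) → ENNReal}
    (hf : Measurable f) :
    ∫⁻ x, f x ∂(Measure.pi μ) =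
      ∫⁻ a, ∫⁻ y, f (Fin.cons a y) ∂(Measure.pi fun j : Fin n => μ j.succ) ∂(μ 0) := by
  have h := (measurePreserving_piFinSuccAbove μ 0).symm
  rw [← h.lintegral_comp hf]
  refine (lintegral_prod (μ := μ 0) (ν := Measure.pi fun j : Fin n => μ (Fin.succAbove 0 j))
    (fun a => f ((MeasurableEquiv.piFinSuccAbove X 0).symm a))
    (hf.comp h.measurable).aemeasurable).trans ?_
  have e : ∀ (a : X 0) (y : ∀ j : Fin n, X j.succ),
      (MeasurableEquiv.piFinSuccAbove X 0).symm (a, y) = Fin.cons a y := fun a y => by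
    simp only [MeasurableEquiv.piFinSuccAbove, Fin.insertNthEquiv_zero]
    rfl
  exact lintegral_congr fun a => lintegral_congr fun y => congrArg f (e a y)

theorem _root_.Measurable.finCons {α X : Type*} [MeasurableSpace α] [MeasurableSpace X] {n : ℕ}
    {f : α → X} {g : α → Fin n → X} (hf : Measurable f) (hg : Measurable g) :
    Measurable fun a => (Fin.cons (f a) (g a) : Fin (n + 1) → X) :=
  measurable_pi_iff.2 fun i => by
    refine Fin.cases ?_ (fun i => ?_) i
    · simpa using hf
    · simpa using measurable_pi_iff.1 hg i

theorem lintegral_pi_prod {n : ℕ} {X : Type*} [MeasurableSpace X] (μ : Fin n → Measure X)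
    [∀ i, SigmaFinite (μ i)] {f : X → ENNReal} (hf : Measurable f) :
    ∫⁻ x, ∏ i, f (x i) ∂(Measure.pi μ) = ∏ i, ∫⁻ a, f a ∂(μ i) := by
  induction n with
  | zero => simp
  | succ n ih =>
    have hm : Measurable fun x : Fin (n + 1) → X => ∏ i, f (x i) :=
      Finset.measurable_fun_prod _ fun i _ => hf.comp (measurable_pi_apply i)
    have hm' : Measurable fun x : Fin n → X => ∏ i, f (x i) :=
      Finset.measurable_fun_prod _ fun i _ => hf.comp (measurable_pi_apply i)
    rw [lintegral_pi_fin_succ μ hm, Fin.prod_univ_succ]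
    simp only [Fin.prod_univ_succ, Fin.cons_zero, Fin.cons_succ]
    simp_rw [lintegral_const_mul _ hm', ih]
    rw [lintegral_mul_const _ hf]

end Pi

/-! ### Runs of several programs -/

namespace Prog

variable {d k : ℕ} [NeZero d]

/-- For fixed seeds the outputs are independent because the register is reset after each run; their
joint law is the product. -/
theorem lintegral_out_runAll {n : ℕ} (Z : UU d) (P : Fin n → Prog d k)
    (g : (Fin n → UU d) → Prog d k) (F : UU d → ENNReal)
    (hg : Measurable fun u => ∫⁻ U, F U ∂((g u).out Z)) :
    ∫⁻ U, F U ∂((runAll P g).out Z) =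
      ∫⁻ u, ∫⁻ U, F U ∂((g u).out Z) ∂(Measure.pi fun i => (P i).out Z) := by
  induction n with
  | zero =>
    rw [Measure.pi_of_empty, lintegral_dirac' _ hg, runAll]
    congr!
  | succ n ih =>
    rw [lintegral_pi_fin_succ _ hg, runAll, lintegral_out_bind]
    refine lintegral_congr fun U => ?_
    rw [ih (Fin.tail P) (fun u => g (Fin.cons U u)) (hg.comp ?_)]
    · rfl
    · exact Measurable.finCons measurable_const measurable_id

theorem lintegral_out_runAll_le {n : ℕ} (Z : UU d) (P : Fin n → Prog d k)
    (g : (Fin n → UU d) → Prog d k) (F : UU d → ENNReal) {b : ENNReal}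
    (hg : ∀ u, ∫⁻ U, F U ∂((g u).out Z) ≤ b) : ∫⁻ U, F U ∂((runAll P g).out Z) ≤ b := by
  induction n with
  | zero => exact hg _
  | succ n ih =>
    rw [runAll, lintegral_out_bind]
    refine (lintegral_mono fun U => ih (Fin.tail P) _ fun u => hg _).trans ?_
    simp

theorem measurable_out_runAll {n : ℕ} (Z : UU d) {α : Type*} [MeasurableSpace α]
    (P : α → Fin n → Prog d k) (g : α → (Fin n → UU d) → Prog d k)
    (hP : ∀ i, Measurable fun a => (P a i).out Z)
    (hg : Measurable fun x : α × (Fin n → UU d) => (g x.1 x.2).out Z) :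
    Measurable fun a => (runAll (P a) (g a)).out Z := by
  induction n generalizing α with
  | zero => exact hg.comp (measurable_id.prodMk measurable_const)
  | succ n ih =>
    refine Measure.measurable_of_measurable_coe _ fun B hB => ?_
    -- The first output joins the parameter, and is then integrated against the kernel of the first
    -- run.
    have hrest := ih (α := α × UU d) (fun x => Fin.tail (P x.1))
      (fun x u => g x.1 (Fin.cons x.2 u))
      (fun i => (hP i.succ).comp measurable_fst)
      (hg.comp ((measurable_fst.comp measurable_fst).prodMk
        (Measurable.finCons (measurable_snd.comp measurable_fst) measurable_snd)))
    let κ : ProbabilityTheory.Kernel α (UU d) := ⟨fun a => (P a 0).out Z, hP 0⟩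
    have : ProbabilityTheory.IsMarkovKernel κ :=
      ⟨fun a => inferInstanceAs (IsProbabilityMeasure ((P a 0).out Z))⟩
    have h := (Measure.measurable_coe hB).comp hrest |>.lintegral_kernel_prod_right' (κ := κ)
    convert h using 1
    funext a
    rw [← lintegral_indicator_one hB, runAll, lintegral_out_bind]
    refine lintegral_congr fun U => ?_
    rw [lintegral_indicator_one hB]
    rfl

end Prog

/-! ### Measurability of the bootstrap -/

section Measurability

variable {d : ℕ}

theorem measurable_pdist_apply {n : ℕ} (i j : Fin n) :
    Measurable fun u : Fin n → UU d => pdist (u i : Matrix (Fin d) (Fin d) ℂ) (u j) := by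
  have h : Measurable fun u : Fin n → UU d => (u i, u j) :=
    (measurable_pi_apply i).prodMk (measurable_pi_apply j)
  simpa only [Function.comp_def] using measurable_pdist.comp h

theorem measurableSet_isCentral {n : ℕ} (r : ℝ) (i : Fin n) :
    MeasurableSet {u : Fin n → UU d | IsCentral r u i} := by
  classical
  have h : ∀ u : Fin n → UU d,
      ({j : Fin n | pdist (u i : Matrix (Fin d) (Fin d) ℂ) (u j) ≤ r}.ncard : ℝ) =
        ∑ j, if pdist (u i : Matrix (Fin d) (Fin d) ℂ) (u j) ≤ r then (1 : ℝ) else 0 := fun u => by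
    rw [Set.ncard_eq_toFinset_card', Finset.sum_boole]
    congr 2
    ext; simp
  simp only [IsCentral, h]
  refine measurableSet_le measurable_const (Finset.measurable_fun_sum _ fun j _ => ?_)
  exact Measurable.ite (measurableSet_le (measurable_pdist_apply i j) measurable_const)
    measurable_const measurable_const

/-- The choice factors through the set of central indices, which takes finitely many values. -/
theorem measurable_central {n : ℕ} (r : ℝ) :
    Measurable (central r : (Fin n → UU d) → UU d) := by
  classical
  let _ : MeasurableSpace (Finset (Fin n)) := ⊤
  let S : (Fin n → UU d) → Finset (Fin n) := fun u => Finset.univ.filter (IsCentral r u)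
  let G : Finset (Fin n) × (Fin n → UU d) → UU d := fun x =>
    if h : x.1.Nonempty then x.2 (x.1.min' h) else 1
  have hS : Measurable S := by
    refine measurable_to_countable' fun s => ?_
    have : S ⁻¹' {s} = ⋂ i, {u | IsCentral r u i ↔ i ∈ s} := by
      ext u
      simp [S, Finset.ext_iff]
    rw [this]
    exact MeasurableSet.iInter fun i => (measurableSet_isCentral r i).iff (.const _)
  have hG : Measurable G := by
    refine measurable_from_prod_countable_right fun s => ?_
    by_cases h : s.Nonempty
    · simpa [G, h] using measurable_pi_apply (X := fun _ : Fin n => UU d) (s.min' h)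
    · simp [G, h]
  have : (central r : (Fin n → UU d) → UU d) = fun u => G (S u, u) := by
    funext u
    simp only [central, G, S]
  rw [this]
  exact hG.comp (hS.prodMk measurable_id)

variable [NeZero d]

/-- The output law is measurable in the seed and continuous in the oracle, hence jointly measurable.
This is needed because the oracle of a round depends on earlier random outputs. -/
theorem Estimator.IsMeasurable.measurable_out {A : Estimator d} (hA : A.IsMeasurable) :
    Measurable fun x : A.Seed × UU d => (A.prog x.1).out x.2 := by
  refine Measure.measurable_of_measurable_coe _ fun B hB => ?_
  have h := measurable_uncurry_of_continuous_of_measurable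
    (u := fun (O : UU d) (s : A.Seed) => (A.prog s).out O B)
    (fun s => Prog.continuous_out (A.prog s) B) (fun O => (Measure.measurable_coe hB).comp (hA O))
  exact h.comp measurable_swap

theorem measurable_out_bootLoop {A : Estimator d} (hA : A.IsMeasurable) {root : ℕ → UU d → UU d}
    (hroot : ∀ p, Measurable (root p)) (r : ℝ) (Z : UU d) {n : ℕ} (p N : Fin n → ℕ) :
    Measurable fun x : ((j : Fin n) → Fin (N j) → A.Seed) × UU d =>
      (bootLoop A root r p N x.1 x.2).out Z := by
  induction n with
  | zero =>
    have h : ∀ V : UU d, (Prog.output V : Prog d A.ancilla).out Z = Measure.dirac V := fun V => by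
      simp [Prog.out, Prog.run, Prog.trace_initial]
    simp only [bootLoop, h]
    exact Measure.measurable_dirac.comp measurable_snd
  | succ n ih =>
    simp only [bootLoop]
    refine Prog.measurable_out_runAll Z _ _ (fun i => ?_) ?_
    · simp only [Prog.out_withOracle]
      refine hA.measurable_out.comp (Measurable.prodMk ?_ ?_)
      · exact (measurable_pi_apply i).comp ((measurable_pi_apply 0).comp measurable_fst)
      · exact (measurable_const.mul measurable_snd.inv).pow_const _
    · refine (ih (fun j => p j.succ) (fun j => N j.succ)).comp (Measurable.prodMk ?_ ?_)
      · exact measurable_pi_lambda _ fun j =>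
          (measurable_pi_apply _).comp (measurable_fst.comp measurable_fst)
      · exact ((hroot _).comp ((measurable_central r).comp measurable_snd)).mul
          (measurable_snd.comp measurable_fst)

theorem isMeasurable_bootstrap (c : ℝ) {A : Estimator d} (hA : A.IsMeasurable)
    {root : ℕ → UU d → UU d} (hroot : ∀ p, Measurable (root p)) (ε₀ ε η : ℝ) :
    (bootstrap c A root ε₀ ε η).IsMeasurable := fun Z => by
  have h := measurable_out_bootLoop hA hroot (2 * ε₀) Z
    (fun j : Fin (rounds ε + 1) => 2 ^ (j : ℕ)) (fun j => repetitions c ε η j)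
  exact h.comp (measurable_id.prodMk (measurable_const (a := (1 : UU d))))

end Measurability

end Tomography

namespace Tomography

/-! ### Central estimates -/

section Central

variable {d : ℕ}

local notation "𝐌" => Matrix (Fin d) (Fin d) ℂ

/-- Every accurate estimate is central, so a central one exists. The neighbours of any central
estimate form a majority that meets the accurate majority, as `0.505 + 0.505 > 1`; the error is at
most `r + 2r`. -/
theorem pdist_central_le {S : 𝐌} (hS : S ∈ unitary 𝐌) {n : ℕ} (hn : 0 < n) {r : ℝ}
    (u : Fin n → UU d) (hu : 0.505 * (n : ℝ) ≤ ({j : Fin n | pdist S (u j) ≤ r}.ncard : ℝ)) :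
    pdist S (central (2 * r) u) ≤ 3 * r := by
  classical
  have hn' : (0 : ℝ) < n := by exact_mod_cast hn
  set G : Set (Fin n) := {j : Fin n | pdist S (u j) ≤ r} with hG
  have hGne : G.Nonempty := by
    rw [← Set.ncard_pos]
    have : (0 : ℝ) < G.ncard := by linarith
    exact_mod_cast this
  obtain ⟨i₀, hi₀⟩ := hGne
  have hcent : IsCentral (2 * r) u i₀ := by
    refine hu.trans (Nat.cast_le.2 (Set.ncard_le_ncard fun j hj => ?_))
    have h1 := pdist_triangle (coe_mem_unitary (u i₀)) hS (coe_mem_unitary (u j))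
    rw [pdist_comm (coe_mem_unitary (u i₀)) hS] at h1
    have h2 : pdist S (u i₀) ≤ r := hi₀
    have h3 : pdist S (u j) ≤ r := hj
    change pdist (u i₀ : 𝐌) (u j) ≤ 2 * r
    linarith
  have hne : (Finset.univ.filter (IsCentral (2 * r) u)).Nonempty :=
    ⟨i₀, by simpa using hcent⟩
  have hmem := Finset.min'_mem _ hne
  set i := (Finset.univ.filter (IsCentral (2 * r) u)).min' hne with hi
  have hval : central (2 * r) u = u i := by rw [central, dif_pos hne]
  have hic : IsCentral (2 * r) u i := (Finset.mem_filter.1 hmem).2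
  have hinter : (G ∩ {j : Fin n | pdist (u i : 𝐌) (u j) ≤ 2 * r}).Nonempty := by
    by_contra hempty
    rw [Set.not_nonempty_iff_eq_empty, ← Set.disjoint_iff_inter_eq_empty] at hempty
    have h1 := Set.ncard_union_eq hempty
    have h2 : (G ∪ {j : Fin n | pdist (u i : 𝐌) (u j) ≤ 2 * r}).ncard ≤ n := by
      simpa using Set.ncard_le_card (G ∪ {j : Fin n | pdist (u i : 𝐌) (u j) ≤ 2 * r})
    rw [h1] at h2
    have h3 : (G.ncard : ℝ) + ({j : Fin n | pdist (u i : 𝐌) (u j) ≤ 2 * r}.ncard : ℝ) ≤ n := by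
      exact_mod_cast h2
    have h4 : 0.505 * (n : ℝ) ≤ ({j : Fin n | pdist (u i : 𝐌) (u j) ≤ 2 * r}.ncard : ℝ) := hic
    linarith
  obtain ⟨j, hj₁, hj₂⟩ := hinter
  have h1 := pdist_triangle hS (coe_mem_unitary (u j)) (coe_mem_unitary (u i))
  rw [pdist_comm (coe_mem_unitary (u j)) (coe_mem_unitary (u i))] at h1
  have h2 : pdist S (u j) ≤ r := hj₁
  have h3 : pdist (u i : 𝐌) (u j) ≤ 2 * r := hj₂
  rw [hval]
  linarith

/-- A round that yields an accurate estimate of the power of `Z V†` improves the estimate of `Z`. -/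
theorem pdist_root_mul_lt {root : ℕ → UU d → UU d} (hroot : IsRootRule root) {Z V U : UU d}
    {m : ℕ} (hV : (m = 0 ∧ V = 1) ∨ pdist (Z : 𝐌) V < 0.04 / 2 ^ m)
    (hU : pdist (((Z * V⁻¹) ^ 2 ^ m : UU d) : 𝐌) U ≤ 1 / 200) :
    pdist (Z : 𝐌) (root (2 ^ m) U * V : UU d) < 0.04 / 2 ^ (m + 1) := by
  have hr := hroot.isProjRoot (2 ^ m) Nat.one_le_two_pow U
  rcases hV with ⟨rfl, rfl⟩ | hV
  · rw [pow_zero] at hr hU ⊢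
    rw [mul_one, pdist_projRoot_one _ hr]
    simp only [inv_one, mul_one, pow_one] at hU
    norm_num
    linarith
  · have h := pdist_projRoot_mul_lt (coe_mem_unitary Z) (coe_mem_unitary U) (coe_mem_unitary V)
      Nat.one_le_two_pow (by push_cast; exact hV) (by simpa using hU) hr
    rw [Submonoid.coe_mul]
    refine h.trans_eq ?_
    push_cast
    rw [pow_succ]
    field_simp
    norm_num

theorem measurable_pdist_right (Z : UU d) : Measurable fun U : UU d => pdist (Z : 𝐌) U := by
  have h : Measurable fun U : UU d => (Z, U) := measurable_const.prodMk measurable_id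
  simpa only [Function.comp_def] using measurable_pdist.comp h

theorem measurableSet_pdist_le (Z : UU d) (r : ℝ) :
    MeasurableSet {U : UU d | pdist (Z : 𝐌) U ≤ r} :=
  measurableSet_le (measurable_pdist_right Z) measurable_const

end Central

/-! ### A Chernoff bound -/

section Chernoff

open Classical in
/-- The exponential weight whose products dominate the event that fewer than `0.505 n` of `n`
points lie in `G`. -/
noncomputable def chernoffWeight {X : Type*} (G : Set X) (x : X) : ENNReal :=
  ENNReal.ofReal (Real.exp (0.01 * (0.505 - if x ∈ G then 1 else 0)))

theorem measurable_chernoffWeight {X : Type*} [MeasurableSpace X] {G : Set X}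
    (hG : MeasurableSet G) : Measurable (chernoffWeight G) := by
  classical
  refine ENNReal.measurable_ofReal.comp (Real.measurable_exp.comp
    (measurable_const.mul (measurable_const.sub ?_)))
  exact Measurable.ite hG measurable_const measurable_const

theorem one_le_prod_chernoffWeight {X : Type*} (G : Set X) {n : ℕ} (u : Fin n → X)
    (hu : ({j | u j ∈ G}.ncard : ℝ) < 0.505 * n) : 1 ≤ ∏ i, chernoffWeight G (u i) := by
  classical
  simp only [chernoffWeight]
  rw [← ENNReal.ofReal_prod_of_nonneg fun i _ => (Real.exp_pos _).le, ← Real.exp_sum,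
    ← Finset.mul_sum, Finset.sum_sub_distrib, Finset.sum_boole, ENNReal.one_le_ofReal,
    Real.one_le_exp_iff]
  rw [Set.ncard_eq_toFinset_card'] at hu
  have : ({j | u j ∈ G} : Set (Fin n)).toFinset = Finset.univ.filter fun j => u j ∈ G := by
    ext; simp
  rw [this] at hu
  simp only [Finset.sum_const, Finset.card_univ, Fintype.card_fin, nsmul_eq_mul]
  nlinarith

/-- The exponent has mean at most `0.01 · (0.505 - 0.51) = -0.00005`, and its values -0.00495 and
0.00505 have squares averaging less than 0.000025. -/
theorem lintegral_chernoffWeight_le {X : Type*} [MeasurableSpace X] (ν : Measure X)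
    [IsProbabilityMeasure ν] {G : Set X} (hG : MeasurableSet G)
    (h : ENNReal.ofReal 0.51 < ν G) :
    ∫⁻ x, chernoffWeight G x ∂ν ≤ ENNReal.ofReal (Real.exp (-0.000025)) := by
  classical
  have hsplit : ∫⁻ x, chernoffWeight G x ∂ν =
      ENNReal.ofReal (Real.exp (-0.00495)) * ν G + ENNReal.ofReal (Real.exp 0.00505) * ν Gᶜ := by
    rw [← lintegral_add_compl _ hG, ← setLIntegral_const, ← setLIntegral_const]
    congr 1
    · refine setLIntegral_congr_fun hG fun x hx => ?_
      rw [chernoffWeight, if_pos hx]; norm_num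
    · refine setLIntegral_congr_fun hG.compl fun x hx => ?_
      rw [chernoffWeight, if_neg hx]; norm_num
  have hq : ν G = ENNReal.ofReal (ν.real G) := (ofReal_measureReal).symm
  have hqc : ν Gᶜ = ENNReal.ofReal (1 - ν.real G) := by
    rw [← probReal_compl_eq_one_sub hG, ofReal_measureReal]
  have hq1 : ν.real G ≤ 1 := measureReal_le_one
  rw [hq, ENNReal.ofReal_lt_ofReal_iff_of_nonneg (by norm_num)] at h
  rw [hsplit, hqc, hq, ← ENNReal.ofReal_mul (Real.exp_pos _).le,
    ← ENNReal.ofReal_mul (Real.exp_pos _).le, ← ENNReal.ofReal_add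
      (mul_nonneg (Real.exp_pos _).le (by linarith)) (mul_nonneg (Real.exp_pos _).le (by linarith))]
  refine ENNReal.ofReal_le_ofReal ?_
  have e1 := Real.abs_exp_sub_one_sub_id_le (x := -0.00495) (by norm_num [abs_le])
  have e2 := Real.abs_exp_sub_one_sub_id_le (x := 0.00505) (by norm_num [abs_le])
  have e3 := Real.add_one_le_exp (-0.000025 : ℝ)
  rw [abs_le] at e1 e2
  generalize Real.exp (-0.00495) = a at *
  generalize Real.exp 0.00505 = b at *
  generalize ν.real G = q at *
  norm_num at e1 e2 e3 ⊢
  nlinarith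

end Chernoff

/-! ### The loop -/

section Loop

variable {d : ℕ} [NeZero d]

local notation "𝐌" => Matrix (Fin d) (Fin d) ℂ

/-- The expectation of `F` at the output of the main loop started with the estimate `V`. -/
noncomputable def expectedLoss (A : Estimator d) (root : ℕ → UU d → UU d) (r : ℝ) (Z : UU d)
    (F : UU d → ENNReal) {n : ℕ} (p N : Fin n → ℕ) (V : UU d) : ENNReal :=
  ∫⁻ s, ∫⁻ U, F U ∂((bootLoop A root r p N s V).out Z)
    ∂(Measure.pi fun j => Measure.pi fun _ : Fin (N j) => A.μ)

theorem lintegral_out_output {k : ℕ} (Z V : UU d) (F : UU d → ENNReal) :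
    ∫⁻ U, F U ∂((Prog.output V : Prog d k).out Z) = F V := by
  simp [Prog.out, Prog.run, Prog.trace_initial]

theorem isProbabilityMeasure_law {A : Estimator d} (hA : A.IsMeasurable) (Z : UU d) :
    IsProbabilityMeasure (A.law Z) :=
  ⟨by rw [Estimator.law, Measure.bind_apply .univ (hA Z).aemeasurable]; simp⟩

/-- The product of weights dominates the bad event of the round. Independence of seeds and runs
turns its expectation into a power of a single-run expectation. -/
theorem expectedLoss_succ_le {A : Estimator d} (hA : A.IsMeasurable) {root : ℕ → UU d → UU d}
    (hroot : ∀ p, Measurable (root p)) (r : ℝ) (Z : UU d) {F : UU d → ENNReal}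
    (hF : Measurable F) {n : ℕ} (p N : Fin (n + 1) → ℕ) (V : UU d) {h : UU d → ENNReal}
    (hh : Measurable h) {b c : ENNReal}
    (hle : ∀ u : Fin (N 0) → UU d,
      expectedLoss A root r Z F (fun j => p j.succ) (fun j => N j.succ)
        (root (p 0) (central r u) * V) ≤ c + b * ∏ i, h (u i)) :
    expectedLoss A root r Z F p N V ≤
      c + b * (∫⁻ U, h U ∂(A.law ((Z * V⁻¹) ^ p 0))) ^ N 0 := by
  set O : UU d := (Z * V⁻¹) ^ p 0 with hO
  let K : ((j : Fin n) → Fin (N j.succ) → A.Seed) → (Fin (N 0) → UU d) → ENNReal := fun s u =>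
    ∫⁻ U, F U ∂((bootLoop A root r (fun j => p j.succ) (fun j => N j.succ) s
      (root (p 0) (central r u) * V)).out Z)
  have hK : Measurable (Function.uncurry K) :=
    (Measure.measurable_lintegral hF).comp ((measurable_out_bootLoop hA hroot r Z
      (fun j => p j.succ) (fun j => N j.succ)).comp (measurable_fst.prodMk
        (((hroot _).comp ((measurable_central r).comp measurable_snd)).mul measurable_const)))
  have hloop : ∀ (s₀ : Fin (N 0) → A.Seed) (s : (j : Fin n) → Fin (N j.succ) → A.Seed),
      ∫⁻ U, F U ∂((bootLoop A root r p N
        (Fin.cons (α := fun j => Fin (N j) → A.Seed) s₀ s) V).out Z) =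
        ∫⁻ u, K s u ∂(Measure.pi fun i => (A.prog (s₀ i)).out O) := fun s₀ s => by
    have hKs : Measurable fun u => K s u := hK.comp (measurable_const.prodMk measurable_id)
    simp only [bootLoop, Fin.cons_zero, Fin.cons_succ]
    rw [Prog.lintegral_out_runAll _ _ _ _ hKs]
    simp only [Prog.out_withOracle]
    rfl
  have hmeas : Measurable fun s : (j : Fin (n + 1)) → Fin (N j) → A.Seed =>
      ∫⁻ U, F U ∂((bootLoop A root r p N s V).out Z) :=
    (Measure.measurable_lintegral hF).comp ((measurable_out_bootLoop hA hroot r Z p N).comp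
      (measurable_id.prodMk measurable_const))
  have hprod : Measurable fun u : Fin (N 0) → UU d => ∏ i, h (u i) :=
    Finset.measurable_fun_prod _ fun i _ => hh.comp (measurable_pi_apply i)
  have hseed : Measurable fun s : A.Seed => ∫⁻ U, h U ∂((A.prog s).out O) :=
    (Measure.measurable_lintegral hh).comp (hA O)
  have hseedprod : Measurable fun s : Fin (N 0) → A.Seed =>
      ∏ i, ∫⁻ U, h U ∂((A.prog (s i)).out O) :=
    Finset.measurable_fun_prod _ fun i _ => hseed.comp (measurable_pi_apply i)
  rw [expectedLoss, lintegral_pi_fin_succ _ hmeas]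
  calc _ ≤ ∫⁻ s₀ : Fin (N 0) → A.Seed, (c + b * ∏ i, ∫⁻ U, h U ∂((A.prog (s₀ i)).out O))
        ∂(Measure.pi fun _ => A.μ) := by
        refine lintegral_mono fun s₀ => ?_
        simp only [hloop]
        -- With the outputs `u` fixed first, the integral over the seeds of later rounds is the
        -- `expectedLoss` in `hle`.
        rw [lintegral_lintegral_swap hK.aemeasurable, ← lintegral_pi_prod _ hh]
        refine (lintegral_mono fun u => hle u).trans_eq ?_
        rw [lintegral_add_left measurable_const, lintegral_const, measure_univ, mul_one,
          lintegral_const_mul _ hprod]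
    _ = c + b * (∫⁻ U, h U ∂(A.law O)) ^ N 0 := by
        rw [lintegral_add_left measurable_const, lintegral_const, measure_univ, mul_one,
          lintegral_const_mul _ hseedprod, lintegral_pi_prod (fun _ => A.μ) hseed,
          Finset.prod_const, Finset.card_univ, Fintype.card_fin, Estimator.law,
          Measure.lintegral_bind (hA O).aemeasurable hh.aemeasurable]

theorem lintegral_out_bootLoop_le {A : Estimator d} {root : ℕ → UU d → UU d}
    (hroot : IsRootRule root) (r : ℝ) (Z : UU d) (F : UU d → ENNReal) {n : ℕ}
    (p N : Fin n → ℕ) (hp : ∀ i, 1 ≤ p i) (s : (j : Fin n) → Fin (N j) → A.Seed) (V : UU d)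
    {b : ENNReal}
    (hF : ∀ U : UU d, pdist (Z : 𝐌) U ≤ pdist (Z : 𝐌) V + ∑ i, Real.pi / p i → F U ≤ b) :
    ∫⁻ U, F U ∂((bootLoop A root r p N s V).out Z) ≤ b := by
  induction n generalizing V with
  | zero =>
    rw [bootLoop, lintegral_out_output]
    exact hF V (by simp)
  | succ n ih =>
    rw [bootLoop]
    refine Prog.lintegral_out_runAll_le _ _ _ _ fun u =>
      ih (fun j => p j.succ) (fun j => N j.succ) (fun j => hp j.succ) _ _ fun U hU => hF U ?_
    have h := pdist_projRoot_mul_le (coe_mem_unitary Z) (coe_mem_unitary V)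
      (hroot.isProjRoot (p 0) (hp 0) (central r u))
    rw [Fin.sum_univ_succ]
    rw [Submonoid.coe_mul] at hU
    linarith

theorem expectedLoss_le_of_forall {A : Estimator d} {root : ℕ → UU d → UU d}
    (hroot : IsRootRule root) (r : ℝ) (Z : UU d) (F : UU d → ENNReal) {n : ℕ}
    (p N : Fin n → ℕ) (hp : ∀ i, 1 ≤ p i) (V : UU d) {b : ENNReal}
    (hF : ∀ U : UU d, pdist (Z : 𝐌) U ≤ pdist (Z : 𝐌) V + ∑ i, Real.pi / p i → F U ≤ b) :
    expectedLoss A root r Z F p N V ≤ b := by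
  refine (lintegral_mono fun s => lintegral_out_bootLoop_le hroot r Z F p N hp s V hF).trans ?_
  simp

theorem sum_pi_div_two_pow_le (m n : ℕ) :
    ∑ i : Fin n, Real.pi / ((2 ^ (m + 1 + (i : ℕ)) : ℕ) : ℝ) ≤ Real.pi / 2 ^ m := by
  have h : ∑ i : Fin n, Real.pi / ((2 ^ (m + 1 + (i : ℕ)) : ℕ) : ℝ) =
      Real.pi / 2 ^ m - Real.pi / 2 ^ (m + n) := by
    rw [Fin.sum_univ_eq_sum_range fun i => Real.pi / ((2 ^ (m + 1 + i) : ℕ) : ℝ)]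
    induction n with
    | zero => simp
    | succ n ih =>
      rw [Finset.sum_range_succ, ih]
      push_cast
      field_simp
      ring
  rw [h]
  have : 0 ≤ Real.pi / 2 ^ (m + n) := by positivity
  linarith

/-- Induction on the remaining rounds, splitting at the first bad one. The alternative `m = 0 ∧ V =
1 ∧ 0 < n` covers the start, where nothing is known about `Z` yet and a round must follow. -/
theorem expectedLoss_le {A : Estimator d} (hA : A.IsMeasurable) {root : ℕ → UU d → UU d}
    (hroot : IsRootRule root) {ε₀ : ℝ} (hε₀ : ε₀ ≤ 1 / 600)
    (hgood : ∀ Z : UU d, ENNReal.ofReal 0.51 < A.law Z {U | pdist (Z : 𝐌) U ≤ ε₀})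
    (Z : UU d) {F : UU d → ENNReal} (hF : Measurable F) {n m : ℕ} (N : Fin n → ℕ)
    (hN : ∀ i, 0 < N i) {V : UU d}
    (hV : (m = 0 ∧ V = 1 ∧ 0 < n) ∨ pdist (Z : 𝐌) V < 0.04 / 2 ^ m) {b : ENNReal}
    (hb : ∀ U : UU d, pdist (Z : 𝐌) U < 0.04 / 2 ^ (m + n) → F U ≤ b) {B : Fin n → ENNReal}
    (hB : ∀ i : Fin n, ∀ U : UU d, pdist (Z : 𝐌) U ≤ 3 * Real.pi / 2 ^ (m + (i : ℕ)) → F U ≤ B i) :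
    expectedLoss A root (2 * ε₀) Z F (fun i => 2 ^ (m + (i : ℕ))) N V ≤
      b + ∑ i, B i * ENNReal.ofReal (Real.exp (-0.000025)) ^ N i := by
  induction n generalizing m V with
  | zero =>
    have hV' : pdist (Z : 𝐌) V < 0.04 / 2 ^ m := by simpa using hV
    have h : expectedLoss A root (2 * ε₀) Z F (fun i : Fin 0 => 2 ^ (m + (i : ℕ))) N V = F V := by
      simp only [expectedLoss, bootLoop, lintegral_out_output]
      simp
    rw [h]
    exact (hb V hV').trans (by simp)
  | succ n ih =>
    set O : UU d := (Z * V⁻¹) ^ 2 ^ m with hO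
    set G : Set (UU d) := {U | pdist (O : 𝐌) U ≤ ε₀} with hG
    have hGm : MeasurableSet G := measurableSet_pdist_le O ε₀
    have hidx : (fun j : Fin n => 2 ^ (m + (j.succ : ℕ))) = fun j : Fin n => 2 ^ (m + 1 + (j : ℕ)) :=
      funext fun j => by rw [Fin.val_succ]; congr 1; ring
    have hdist : pdist (Z : 𝐌) V ≤ Real.pi / 2 ^ m := by
      rcases hV with ⟨rfl, -, -⟩ | hV
      · simpa using pdist_le_pi (coe_mem_unitary Z) (coe_mem_unitary V)
      · refine hV.le.trans ?_
        gcongr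
        linarith [Real.pi_gt_three]
    have key := expectedLoss_succ_le hA hroot.measurable (2 * ε₀) Z hF
      (fun i : Fin (n + 1) => 2 ^ (m + (i : ℕ))) N V (measurable_chernoffWeight hGm)
      (b := B 0) (c := b + ∑ i : Fin n, B i.succ *
        ENNReal.ofReal (Real.exp (-0.000025)) ^ N i.succ) ?_
    · simp only [Fin.val_zero, add_zero] at key
      refine key.trans ?_
      rw [Fin.sum_univ_succ, add_assoc, add_comm (∑ _, _)]
      have := isProbabilityMeasure_law hA O
      gcongr
      exact lintegral_chernoffWeight_le _ hGm (hgood O)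
    · intro u
      simp only [Fin.val_zero, add_zero, hidx]
      -- In the bad case the error before the round, the step of this round and all later steps
      -- together contribute at most `π / 2^m` each.
      by_cases hu : ({j | u j ∈ G}.ncard : ℝ) < 0.505 * (N 0 : ℝ)
      · refine le_trans ?_ (le_add_left (le_mul_of_one_le_right zero_le
          (one_le_prod_chernoffWeight G u hu)))
        refine expectedLoss_le_of_forall hroot _ Z F _ _ (fun _ => Nat.one_le_two_pow) _
          fun U hU => hB 0 U (hU.trans ?_)
        have h1 := pdist_projRoot_mul_le (coe_mem_unitary Z) (coe_mem_unitary V)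
          (hroot.isProjRoot (2 ^ m) Nat.one_le_two_pow (central (2 * ε₀) u))
        have h2 := sum_pi_div_two_pow_le m n
        rw [Submonoid.coe_mul]
        push_cast at h1 h2 ⊢
        simp only [Fin.val_zero, add_zero]
        have h3 : 3 * Real.pi / 2 ^ m = Real.pi / 2 ^ m + Real.pi / 2 ^ m + Real.pi / 2 ^ m := by
          ring
        rw [h3]
        linarith
      · refine le_trans ?_ le_self_add
        have hc := pdist_central_le (coe_mem_unitary O) (hN 0) u (not_lt.1 hu)
        refine ih (fun j => N j.succ) (fun j => hN j.succ) (Or.inr (pdist_root_mul_lt hroot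
          (hV.imp (fun h => ⟨h.1, h.2.1⟩) id) (hc.trans (by linarith)))) (fun U hU => hb U ?_)
          (fun i U hU => hB i.succ U ?_)
        · rwa [add_assoc, add_comm 1] at hU
        · rwa [add_assoc, add_comm 1] at hU

end Loop

end Tomography

namespace Tomography

/-! ### Parameters of the bootstrap -/

section Parameters

variable {ε η : ℝ}

theorem one_div_le_two_pow_rounds (hε : ε ∈ Set.Ioo (0 : ℝ) 1) : 1 / ε ≤ 2 ^ rounds ε := by
  have h : Real.logb 2 (1 / ε) ≤ (rounds ε : ℝ) := Nat.le_ceil _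
  rw [Real.logb_le_iff_le_rpow one_lt_two (one_div_pos.2 hε.1)] at h
  simpa using h

theorem two_pow_rounds_le (hε : ε ∈ Set.Ioo (0 : ℝ) 1) : 2 ^ rounds ε ≤ 2 * (1 / ε) := by
  have h0 : 0 ≤ Real.logb 2 (1 / ε) :=
    Real.logb_nonneg one_lt_two (by rw [le_div_iff₀ hε.1]; linarith [hε.2])
  have h : (rounds ε : ℝ) - 1 ≤ Real.logb 2 (1 / ε) := by
    have := Nat.ceil_lt_add_one h0
    have h' : (rounds ε : ℝ) < Real.logb 2 (1 / ε) + 1 := this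
    linarith
  rw [Real.le_logb_iff_rpow_le one_lt_two (one_div_pos.2 hε.1), Real.rpow_sub two_pos,
    Real.rpow_natCast, Real.rpow_one] at h
  linarith

theorem failure_eq (ε η : ℝ) (j : ℕ) : failure ε η j = η * 8 ^ j / 8 ^ (rounds ε + 1) := by
  rw [failure, sub_sub, zpow_sub₀ (by norm_num), zpow_natCast, mul_div_assoc]
  norm_cast

theorem failure_pos (hη : η ∈ Set.Ioo (0 : ℝ) 1) (j : ℕ) : 0 < failure ε η j :=
  mul_pos hη.1 (by positivity)

theorem failure_lt_one (hη : η ∈ Set.Ioo (0 : ℝ) 1) {j : ℕ} (hj : j ≤ rounds ε) :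
    failure ε η j < 1 := by
  rw [failure_eq, div_lt_one (by positivity)]
  calc η * 8 ^ j < 1 * 8 ^ j := by gcongr; exact hη.2
    _ = 8 ^ j := one_mul _
    _ ≤ 8 ^ (rounds ε + 1) := pow_le_pow_right₀ (by norm_num) (by omega)

theorem repetitions_pos {c : ℝ} (hc : 0 < c) (hη : η ∈ Set.Ioo (0 : ℝ) 1) {j : ℕ}
    (hj : j ≤ rounds ε) : 0 < repetitions c ε η j :=
  Nat.ceil_pos.2 (mul_pos hc (Real.log_pos (one_lt_one_div (failure_pos hη j)
    (failure_lt_one hη hj))))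

/-- The constant 40000 is the inverse of the Chernoff rate 0.000025. -/
theorem exp_pow_repetitions_le (hη : η ∈ Set.Ioo (0 : ℝ) 1) (j : ℕ) :
    ENNReal.ofReal (Real.exp (-0.000025)) ^ repetitions 40000 ε η j ≤
      ENNReal.ofReal (failure ε η j) := by
  rw [← ENNReal.ofReal_pow (Real.exp_pos _).le, ← Real.exp_nat_mul]
  refine ENNReal.ofReal_le_ofReal ?_
  rw [← Real.le_log_iff_exp_le (failure_pos hη j)]
  have h : 40000 * Real.log (1 / failure ε η j) ≤ (repetitions 40000 ε η j : ℝ) := Nat.le_ceil _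
  rw [one_div, Real.log_inv] at h
  linarith

theorem sum_failure_le (hη : η ∈ Set.Ioo (0 : ℝ) 1) :
    ∑ j : Fin (rounds ε + 1), failure ε η j ≤ η := by
  simp only [failure_eq]
  rw [Fin.sum_univ_eq_sum_range fun j => η * 8 ^ j / 8 ^ (rounds ε + 1), ← Finset.sum_div,
    ← Finset.mul_sum, geom_sum_eq (by norm_num), div_le_iff₀ (by positivity)]
  have h : (0 : ℝ) < 8 ^ (rounds ε + 1) := by positivity
  have := hη.1
  gcongr
  linarith

/-- Since `8^j / 4^j = 2^j`, the sum is geometric and at most `9π²/4 · η / 4^T`, where `9π²/4 ≤ 32`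
and `1 / 2^T ≤ ε`. -/
theorem sum_sq_mul_failure_le (hε : ε ∈ Set.Ioo (0 : ℝ) 1) (hη : η ∈ Set.Ioo (0 : ℝ) 1) :
    ∑ j : Fin (rounds ε + 1), (3 * Real.pi / 2 ^ (j : ℕ)) ^ 2 * failure ε η j ≤
      32 * η * ε ^ 2 := by
  have hη0 := hη.1
  set T := rounds ε with hT
  have hterm : ∀ j : ℕ, (3 * Real.pi / 2 ^ j) ^ 2 * failure ε η j =
      9 * Real.pi ^ 2 * η / 8 ^ (T + 1) * 2 ^ j := fun j => by
    have h8 : (8 : ℝ) ^ j = (2 ^ j) ^ 3 := by rw [← pow_mul, mul_comm, pow_mul]; norm_num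
    rw [failure_eq, h8]
    field_simp
    ring
  have h1 := one_div_le_two_pow_rounds hε
  rw [div_le_iff₀ hε.1, ← hT] at h1
  have h2 : 1 ≤ (ε * 2 ^ T) ^ 2 := one_le_pow₀ (by linarith)
  have h8 : (8 : ℝ) ^ (T + 1) = 8 * (2 ^ T) ^ 3 := by
    rw [pow_succ, ← pow_mul, mul_comm T, pow_mul]; norm_num; ring
  simp only [hterm]
  rw [← Finset.mul_sum, Fin.sum_univ_eq_sum_range fun j => (2 : ℝ) ^ j,
    geom_sum_eq (by norm_num), h8, pow_succ 2 T]
  have hp : (0 : ℝ) < 2 ^ T := by positivity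
  generalize (2 : ℝ) ^ T = x at *
  calc 9 * Real.pi ^ 2 * η / (8 * x ^ 3) * ((x * 2 - 1) / (2 - 1))
      ≤ 9 * Real.pi ^ 2 * η / (8 * x ^ 3) * (x * 2) := by
        have : (x * 2 - 1) / (2 - 1) ≤ x * 2 := by norm_num
        gcongr
    _ = (9 / 4 * Real.pi ^ 2) * η / x ^ 2 * 1 := by field_simp; norm_num
    _ ≤ 32 * η / x ^ 2 * (ε * x) ^ 2 := by
        have : 9 / 4 * Real.pi ^ 2 ≤ 32 := by nlinarith [Real.pi_lt_d2, Real.pi_pos]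
        gcongr
    _ = 32 * η * ε ^ 2 := by field_simp

theorem sum_two_pow_mul_sub (T : ℕ) :
    ∑ j ∈ Finset.range (T + 1), (2 : ℝ) ^ j * (T + 1 - j) = 2 ^ (T + 2) - T - 3 := by
  induction T with
  | zero => norm_num
  | succ T ih =>
    have h : ∀ j ∈ Finset.range (T + 1), (2 : ℝ) ^ j * ((T + 1 : ℕ) + 1 - j) =
        2 ^ j * (T + 1 - j) + 2 ^ j := fun j _ => by push_cast; ring
    rw [Finset.sum_range_succ, Finset.sum_congr rfl h, Finset.sum_add_distrib, ih,
      geom_sum_eq (by norm_num)]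
    push_cast
    ring

theorem repetitions_le {c : ℝ} (hc : 0 < c) (hη : η ∈ Set.Ioo (0 : ℝ) 1) {j : ℕ}
    (hj : j ≤ rounds ε) :
    (repetitions c ε η j : ℝ) ≤
      max 1 (Real.log (1 / η)) * (c + 1 + 3 * c * (rounds ε + 1 - j)) := by
  set L := max 1 (Real.log (1 / η)) with hL
  have hL1 : 1 ≤ L := le_max_left _ _
  have hL2 : Real.log (1 / η) ≤ L := le_max_right _ _
  have hlog0 : 0 ≤ Real.log (1 / failure ε η j) :=
    (Real.log_pos (one_lt_one_div (failure_pos hη j) (failure_lt_one hη hj))).le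
  have h1 : (repetitions c ε η j : ℝ) ≤ c * Real.log (1 / failure ε η j) + 1 :=
    (Nat.ceil_lt_add_one (mul_nonneg hc.le hlog0)).le
  have hlog : Real.log (1 / failure ε η j) =
      Real.log (1 / η) + (rounds ε + 1 - j) * Real.log 8 := by
    rw [failure_eq, one_div, one_div, Real.log_inv, Real.log_inv, Real.log_div
      (mul_ne_zero hη.1.ne' (by positivity)) (by positivity),
      Real.log_mul hη.1.ne' (by positivity), Real.log_pow, Real.log_pow]
    push_cast
    ring
  have h8 : Real.log 8 ≤ 3 := by
    have : (8 : ℝ) = 2 ^ 3 := by norm_num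
    rw [this, Real.log_pow]
    have := Real.log_two_lt_d9
    push_cast
    linarith
  have hj' : (0 : ℝ) ≤ rounds ε + 1 - j := by
    have : (j : ℝ) ≤ rounds ε := by exact_mod_cast hj
    linarith
  rw [hlog] at h1
  have h2 : (rounds ε + 1 - j : ℝ) * Real.log 8 ≤ (rounds ε + 1 - j) * 3 := by gcongr
  have h3 : c * (Real.log (1 / η) + (rounds ε + 1 - j) * Real.log 8) ≤
      c * (L + (rounds ε + 1 - j) * 3) := by gcongr
  -- As `L ≥ 1`, the factor `L` can be put in front of the terms that do not involve `η`.
  have h4 : 0 ≤ (L - 1) * (3 * c * (rounds ε + 1 - j)) :=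
    mul_nonneg (by linarith) (mul_nonneg (by linarith) hj')
  nlinarith

theorem sum_repetitions_mul_le {c : ℝ} (hc : 0 < c) (hε : ε ∈ Set.Ioo (0 : ℝ) 1)
    (hη : η ∈ Set.Ioo (0 : ℝ) 1) :
    ∑ j : Fin (rounds ε + 1), (repetitions c ε η j : ℝ) * 2 ^ (j : ℕ) ≤
      (28 * c + 4) * (1 / ε * max 1 (Real.log (1 / η))) := by
  set L := max 1 (Real.log (1 / η)) with hL
  have hL1 : 1 ≤ L := le_max_left _ _
  set T := rounds ε with hT
  calc ∑ j : Fin (T + 1), (repetitions c ε η j : ℝ) * 2 ^ (j : ℕ)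
      ≤ ∑ j : Fin (T + 1), (L * (c + 1) * 2 ^ (j : ℕ) +
          3 * c * L * (2 ^ (j : ℕ) * (T + 1 - (j : ℕ)))) := by
        refine Finset.sum_le_sum fun j _ => ?_
        have h := repetitions_le hc hη (Nat.lt_succ_iff.1 j.2)
        refine (mul_le_mul_of_nonneg_right h (by positivity)).trans_eq ?_
        ring
    _ = L * (c + 1) * (2 ^ (T + 1) - 1) + 3 * c * L * (2 ^ (T + 2) - T - 3) := by
        rw [Fin.sum_univ_eq_sum_range fun j => L * (c + 1) * (2 : ℝ) ^ j +
          3 * c * L * (2 ^ j * (T + 1 - j)), Finset.sum_add_distrib, ← Finset.mul_sum,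
          ← Finset.mul_sum, sum_two_pow_mul_sub, geom_sum_eq (by norm_num)]
        norm_num
    _ ≤ L * (c + 1) * 2 ^ (T + 1) + 3 * c * L * 2 ^ (T + 2) := by
        have : (0 : ℝ) ≤ T := Nat.cast_nonneg T
        gcongr <;> linarith
    _ = (14 * c + 2) * L * 2 ^ T := by ring
    _ ≤ (14 * c + 2) * L * (2 * (1 / ε)) := by
        gcongr
        exact two_pow_rounds_le hε
    _ = _ := by ring

end Parameters

/-! ### Conclusion -/

section Bootstrap

variable {d : ℕ} [NeZero d]

local notation "𝐌" => Matrix (Fin d) (Fin d) ℂ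

theorem queries_bootLoop_le {A : Estimator d} (root : ℕ → UU d → UU d) (r : ℝ) {Q : ℕ}
    (hQ : ∀ s, (A.prog s).queries ≤ Q) {n : ℕ} (p N : Fin n → ℕ)
    (s : (j : Fin n) → Fin (N j) → A.Seed) (V : UU d) :
    (bootLoop A root r p N s V).queries ≤ ∑ j, N j * (p j * Q) := by
  induction n generalizing V with
  | zero => simp [bootLoop, Prog.queries]
  | succ n ih =>
    rw [bootLoop, Fin.sum_univ_succ]
    exact Prog.queries_runAll_le _ _
      (fun i => (Prog.queries_withOracle_le _ _ _).trans (Nat.mul_le_mul_left _ (hQ _)))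
      fun u => ih _ _ _ _

theorem usesAtMost_bootstrap {c : ℝ} (hc : 0 < c) (A : Estimator d) (root : ℕ → UU d → UU d)
    (ε₀ : ℝ) {ε η : ℝ} (hε : ε ∈ Set.Ioo (0 : ℝ) 1) (hη : η ∈ Set.Ioo (0 : ℝ) 1) {Q : ℕ}
    (hQ : A.UsesAtMost Q) :
    (bootstrap c A root ε₀ ε η).UsesAtMost
      ((28 * c + 4) * (Q / ε * max 1 (Real.log (1 / η)))) := fun s => by
  have h := queries_bootLoop_le root (2 * ε₀) (fun s => Nat.cast_le.1 (hQ s))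
    (fun j : Fin (rounds ε + 1) => 2 ^ (j : ℕ)) (fun j => repetitions c ε η j) s 1
  have h' : (((bootstrap c A root ε₀ ε η).prog s).queries : ℝ) ≤
      ((∑ j : Fin (rounds ε + 1), repetitions c ε η j * (2 ^ (j : ℕ) * Q) : ℕ) : ℝ) :=
    Nat.cast_le.2 h
  refine h'.trans ?_
  push_cast
  simp only [← mul_assoc]
  rw [← Finset.sum_mul]
  refine (mul_le_mul_of_nonneg_right (sum_repetitions_mul_le hc hε hη)
    (Nat.cast_nonneg Q)).trans_eq ?_
  ring

/-- Stated for a general loss `F`, so that the tail bound and the second moment both follow from one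
analysis. -/
theorem lintegral_law_bootstrap_le {A : Estimator d} (hA : A.IsMeasurable)
    {root : ℕ → UU d → UU d} (hroot : IsRootRule root) {ε₀ : ℝ} (hε₀ : ε₀ ≤ 1 / 600)
    (hgood : ∀ Z : UU d, ENNReal.ofReal 0.51 < A.law Z {U | pdist (Z : 𝐌) U ≤ ε₀})
    {ε η : ℝ} (hε : ε ∈ Set.Ioo (0 : ℝ) 1) (hη : η ∈ Set.Ioo (0 : ℝ) 1) (Z : UU d)
    {F : UU d → ENNReal} (hF : Measurable F) {b : ENNReal}
    (hb : ∀ U : UU d, pdist (Z : 𝐌) U ≤ ε → F U ≤ b) {B : ℕ → ENNReal}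
    (hB : ∀ (i : ℕ) (U : UU d), pdist (Z : 𝐌) U ≤ 3 * Real.pi / 2 ^ i → F U ≤ B i) :
    ∫⁻ U, F U ∂((bootstrap 40000 A root ε₀ ε η).law Z) ≤
      b + ∑ j : Fin (rounds ε + 1), B j * ENNReal.ofReal (failure ε η j) := by
  have hmeas := isMeasurable_bootstrap 40000 hA hroot.measurable ε₀ ε η
  rw [Estimator.law, Measure.lintegral_bind (hmeas Z).aemeasurable hF.aemeasurable]
  have h := expectedLoss_le hA hroot hε₀ hgood Z hF (n := rounds ε + 1) (m := 0)
    (fun j => repetitions 40000 ε η j)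
    (fun j => repetitions_pos (by norm_num) hη (Nat.lt_succ_iff.1 j.2)) (V := 1)
    (Or.inl ⟨rfl, rfl, Nat.succ_pos _⟩) (b := b) (fun U hU => hb U (hU.le.trans ?_))
    (B := fun j => B j) (fun i U hU => hB i U (by simpa using hU))
  · simp only [zero_add] at h
    refine le_trans h ?_
    gcongr
    exact exp_pow_repetitions_le hη _
  · have h1 := one_div_le_two_pow_rounds hε
    rw [div_le_iff₀ hε.1] at h1
    rw [zero_add, div_le_iff₀ (by positivity), pow_succ]
    linarith

end Bootstrap

end Tomography

theorem theorem4 :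
    ∃ c C : ℝ, 0 < c ∧ 0 < C ∧
      ∀ (d : ℕ) [NeZero d] (A : Tomography.Estimator d) (root : ℕ → Tomography.UU d → Tomography.UU d)
        (ε₀ ε η : ℝ),
        A.IsMeasurable →
        Tomography.IsRootRule root →
        ε₀ ≤ 1 / 600 →
        (∀ Z : Tomography.UU d,
          ENNReal.ofReal 0.51 <
            A.law Z {U | Tomography.pdist (Z : Matrix (Fin d) (Fin d) ℂ) U ≤ ε₀}) →
        ε ∈ Set.Ioo (0 : ℝ) 1 → η ∈ Set.Ioo (0 : ℝ) 1 →
        (Tomography.bootstrap c A root ε₀ ε η).IsMeasurable ∧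
        (∀ Z : Tomography.UU d,
          ENNReal.ofReal (1 - η) ≤ (Tomography.bootstrap c A root ε₀ ε η).law Z
            {U | Tomography.pdist (Z : Matrix (Fin d) (Fin d) ℂ) U ≤ ε}) ∧
        (∀ Z : Tomography.UU d,
          ∫⁻ U, ENNReal.ofReal (Tomography.pdist (Z : Matrix (Fin d) (Fin d) ℂ) U ^ 2)
              ∂((Tomography.bootstrap c A root ε₀ ε η).law Z) ≤
            ENNReal.ofReal ((1 + 32 * η) * ε ^ 2)) ∧
        (∀ Q : ℕ, A.UsesAtMost Q →
          (Tomography.bootstrap c A root ε₀ ε η).UsesAtMost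
            (C * (Q / ε * max 1 (Real.log (1 / η))))) := by
  -- The second constant is the factor `28 c + 4` of `usesAtMost_bootstrap` at `c = 40000`.
  refine ⟨40000, 28 * 40000 + 4, by norm_num, by norm_num, ?_⟩
  intro d _ A root ε₀ ε η hA hroot hε₀ hgood hε hη
  refine ⟨Tomography.isMeasurable_bootstrap _ hA hroot.measurable ε₀ ε η, fun Z => ?_,
    fun Z => ?_, fun Q hQ => Tomography.usesAtMost_bootstrap (by norm_num) A root ε₀ hε hη hQ⟩
  · set G : Set (Tomography.UU d) :=
      {U | Tomography.pdist (Z : Matrix (Fin d) (Fin d) ℂ) U ≤ ε} with hG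
    have hGm : MeasurableSet G := Tomography.measurableSet_pdist_le Z ε
    have := Tomography.isProbabilityMeasure_law
      (Tomography.isMeasurable_bootstrap 40000 hA hroot.measurable ε₀ ε η) Z
    -- The loss is the indicator of failure: 0 on accurate outputs and at most 1 otherwise, so the
    -- bound is the sum of the `η_j`.
    have h := Tomography.lintegral_law_bootstrap_le hA hroot hε₀ hgood hε hη Z
      (F := Gᶜ.indicator 1) (measurable_one.indicator hGm.compl) (b := 0)
      (fun U hU => by
        rw [Set.indicator_of_notMem]
        exact fun h => h hU)
      (B := fun _ => 1) (fun i U _ => Set.indicator_le_self' (fun _ _ => zero_le) U)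
    rw [lintegral_indicator_one hGm.compl] at h
    simp only [one_mul, zero_add] at h
    rw [← ENNReal.ofReal_sum_of_nonneg fun (j : Fin (Tomography.rounds ε + 1)) _ =>
      (Tomography.failure_pos (ε := ε) hη j).le] at h
    have h2 := h.trans (ENNReal.ofReal_le_ofReal (Tomography.sum_failure_le hη))
    rw [prob_compl_eq_one_sub hGm] at h2
    rw [ENNReal.ofReal_sub _ hη.1.le, ENNReal.ofReal_one]
    exact tsub_le_iff_tsub_le.1 h2
  · have h := Tomography.lintegral_law_bootstrap_le hA hroot hε₀ hgood hε hη Z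
      (F := fun U => ENNReal.ofReal (Tomography.pdist (Z : Matrix (Fin d) (Fin d) ℂ) U ^ 2))
      (ENNReal.measurable_ofReal.comp ((Tomography.measurable_pdist_right Z).pow_const 2))
      (b := ENNReal.ofReal (ε ^ 2))
      (fun U hU => ENNReal.ofReal_le_ofReal
        (pow_le_pow_left₀ (Tomography.pdist_nonneg _ _) hU 2))
      (B := fun i => ENNReal.ofReal ((3 * Real.pi / 2 ^ i) ^ 2))
      (fun i U hU => ENNReal.ofReal_le_ofReal
        (pow_le_pow_left₀ (Tomography.pdist_nonneg _ _) hU 2))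
    refine h.trans ?_
    have hf : ∀ j : ℕ, 0 ≤ (3 * Real.pi / 2 ^ j) ^ 2 * Tomography.failure ε η j := fun j =>
      mul_nonneg (sq_nonneg _) (Tomography.failure_pos hη j).le
    simp only [← ENNReal.ofReal_mul (sq_nonneg _)]
    rw [← ENNReal.ofReal_sum_of_nonneg fun (j : Fin (Tomography.rounds ε + 1)) _ => hf j,
      ← ENNReal.ofReal_add (sq_nonneg _)
        (Finset.sum_nonneg fun (j : Fin (Tomography.rounds ε + 1)) _ => hf j)]
    refine ENNReal.ofReal_le_ofReal ?_
    have := Tomography.sum_sq_mul_failure_le hε hη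
    linarith
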